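/- For $z\in\mathbb{C}$ and $b>0$ let $L_{z,b}$ be the operator in $L^2(\mathbb{R})$ formally given by \[ L_{z,b}\,y(x) = -y''(x) + \Bigl(\tfrac{x^2}{4}-\tfrac12\Bigr)y(x) + z\,\bigl[\delta(x-b)-\delta(x+b)\bigr]y(x), \] that is, the operator associated with the quadratic form \[ t_{z,b}(f,g) = \langle f',g'\rangle + \tfrac14\langle xf,xg\rangle - \tfrac12\langle f,g\rangle + z\bigl(f(b)\overline{g(b)} - f(-b)\overline{g(-b)}\bigr) \] with domain $\{f\in H^1(\mathbb{R}) : xf\in L^2(\mathbb{R})\}$, where $\langle u,v\rangle=\int_{\mathbb{R}}u\overline{v}\,dx$: $f$ belongs to the domain of $L_{z,b}$ and $L_{z,b}f=h\in L^2(\mathbb{R})$ if and only if $f$ belongs to the form domain and $t_{z,b}(f,g)=\langle h,g\rangle$ for every $g$ in the form domain. Let $D_\nu(x)$ denote the parabolic cylinder function, i.e. the solution of $-y''+(\tfrac{x^2}{4}-\tfrac12)y=\nu y$ with \[ D_\nu(0)=\frac{2^{\nu/2}\sqrt\pi}{\Gamma(\frac12-\frac\nu2)},\qquad D_\nu'(0)=-\frac{2^{(\nu+1)/2}\sqrt\pi}{\Gamma(-\frac\nu2)},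 \] where $1/\Gamma$ is the entire reciprocal Gamma function. Let $b>0$, let $\lambda>0$ be a real number that is not an integer and such that $D_\lambda(b)=0$, and let $\rho>0$. Then there is a constant $\delta=\delta(b,\lambda,\rho)>0$ such that for every real $r>1/\delta$ the operator $L_{ir,b}$ has two distinct non-real eigenvalues $\nu_1\neq\nu_2$ with $|\nu_1-\lambda|<\rho$ and $|\nu_2-\lambda|<\rho$. -/

import Mathlib

open MeasureTheory
open scoped ContDiff ComplexConjugate

namespace PointHarmonic

/-! ### Parabolic cylinder functions -/

/-- The even solution of the Weber equation `-y'' + (x²/4 - 1/2) y = ν y`,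
`e^{-x²/4} [1 + (-ν) x²/2! + (-ν)(-ν+2) x⁴/4! + ⋯]`, with `y(0) = 1`, `y'(0) = 0`. -/
noncomputable def yEven (ν x : ℂ) : ℂ :=
  Complex.exp (-x ^ 2 / 4) *
    ∑' k : ℕ, (∏ j ∈ Finset.range k, (-ν + 2 * (j : ℂ))) * x ^ (2 * k) /
      (Nat.factorial (2 * k) : ℂ)

/-- The odd solution of the Weber equation `-y'' + (x²/4 - 1/2) y = ν y`,
`e^{-x²/4} [x + (-ν+1) x³/3! + (-ν+1)(-ν+3) x⁵/5! + ⋯]`, with `y(0) = 0`, `y'(0) = 1`. -/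
noncomputable def yOdd (ν x : ℂ) : ℂ :=
  Complex.exp (-x ^ 2 / 4) *
    ∑' k : ℕ, (∏ j ∈ Finset.range k, (-ν + 1 + 2 * (j : ℂ))) * x ^ (2 * k + 1) /
      (Nat.factorial (2 * k + 1) : ℂ)

/-- The parabolic cylinder function `D_ν(x)`: the solution of the Weber equation with
`D_ν(0) = 2^{ν/2} √π / Γ(1/2 - ν/2)` and `D_ν'(0) = -2^{(ν+1)/2} √π / Γ(-ν/2)`.
Mathlib's `Complex.Gamma` is `0` at its poles, so that `(Complex.Gamma s)⁻¹` is the entire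
function `1/Γ` everywhere. -/
noncomputable def parabolicD (ν x : ℂ) : ℂ :=
  (2 : ℂ) ^ (ν / 2) * (Real.sqrt Real.pi : ℂ) * (Complex.Gamma (-ν / 2 + 1 / 2))⁻¹ * yEven ν x -
    (2 : ℂ) ^ ((ν + 1) / 2) * (Real.sqrt Real.pi : ℂ) * (Complex.Gamma (-ν / 2))⁻¹ * yOdd ν x

/-! ### The quadratic form -/

/-- `f'` is the weak (distributional) derivative of `f` on the real line. -/
def IsWeakDeriv (f f' : ℝ → ℂ) : Prop :=
  ∀ φ : ℝ → ℂ, ContDiff ℝ ∞ φ → HasCompactSupport φ →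
    ∫ x, f x * deriv φ x = -∫ x, f' x * φ x

/-- The pairing `⟨u, v⟩ = ∫ u v̄` of `L²(ℝ)`, linear in the first argument. -/
noncomputable def l2Pairing (u v : ℝ → ℂ) : ℂ := ∫ x, u x * conj (v x)

/-- The form domain `{f ∈ H¹(ℝ) : x f(x) ∈ L²(ℝ)}`. An element of `H¹(ℝ)` is given by its
continuous representative together with (a representative of) its weak derivative, which is
determined almost everywhere by the function. -/
structure FormDomain where
  /-- the continuous representative -/
  toFun : ℝ → ℂ
  /-- the weak derivative -/
  wderiv : ℝ → ℂ
  continuous_toFun : Continuous toFun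
  memLp_toFun : MemLp toFun 2 volume
  memLp_wderiv : MemLp wderiv 2 volume
  isWeakDeriv : IsWeakDeriv toFun wderiv
  memLp_mul : MemLp (fun x : ℝ => (x : ℂ) * toFun x) 2 volume

/-- The quadratic form of `-d²/dx² + (x²/4 - 1/2) + z (δ(x - b) - δ(x + b))`:
`⟨f', g'⟩ + ¼ ⟨x f, x g⟩ - ½ ⟨f, g⟩ + z (f(b) g(b)‾ - f(-b) g(-b)‾)`. -/
noncomputable def pcForm (z : ℂ) (b : ℝ) (f g : FormDomain) : ℂ :=
  l2Pairing f.wderiv g.wderiv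
    + 1 / 4 * l2Pairing (fun x : ℝ => (x : ℂ) * f.toFun x) (fun x : ℝ => (x : ℂ) * g.toFun x)
    - 1 / 2 * l2Pairing f.toFun g.toFun
    + z * (f.toFun b * conj (g.toFun b) - f.toFun (-b) * conj (g.toFun (-b)))

/-! ### Auxiliary facts: linearity in the first argument, and density of the form domain -/

theorem integrable_mul_conj {u v : ℝ → ℂ} (hu : MemLp u 2 volume) (hv : MemLp v 2 volume) :
    Integrable (fun x => u x * conj (v x)) :=
  hu.integrable_mul hv.star

theorem l2Pairing_add {u u' v : ℝ → ℂ} (hu : MemLp u 2 volume) (hu' : MemLp u' 2 volume)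
    (hv : MemLp v 2 volume) :
    l2Pairing (fun x => u x + u' x) v = l2Pairing u v + l2Pairing u' v := by
  unfold l2Pairing
  rw [← integral_add (integrable_mul_conj hu hv) (integrable_mul_conj hu' hv)]
  simp only [add_mul]

theorem l2Pairing_smul (c : ℂ) (u v : ℝ → ℂ) :
    l2Pairing (fun x => c * u x) v = c * l2Pairing u v := by
  unfold l2Pairing
  rw [← integral_const_mul]
  simp only [mul_assoc]

theorem l2Pairing_congr {u u' : ℝ → ℂ} (h : u =ᵐ[volume] u') (v : ℝ → ℂ) :
    l2Pairing u v = l2Pairing u' v := by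
  unfold l2Pairing
  apply integral_congr_ae
  filter_upwards [h] with x hx
  rw [hx]

theorem memLp_test {φ : ℝ → ℂ} (hφ : Continuous φ) (hc : HasCompactSupport φ) :
    MemLp φ 2 volume :=
  hφ.memLp_of_hasCompactSupport hc

namespace FormDomain

/-- The sum of two elements of the form domain. -/
def add (f g : FormDomain) : FormDomain where
  toFun x := f.toFun x + g.toFun x
  wderiv x := f.wderiv x + g.wderiv x
  continuous_toFun := f.continuous_toFun.add g.continuous_toFun
  memLp_toFun := f.memLp_toFun.add g.memLp_toFun
  memLp_wderiv := f.memLp_wderiv.add g.memLp_wderiv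
  isWeakDeriv := by
    intro φ hφ hc
    have hd : MemLp (deriv φ) 2 volume :=
      memLp_test (hφ.continuous_deriv (by simp)) hc.deriv
    have h0 : MemLp φ 2 volume := memLp_test hφ.continuous hc
    have i1 : Integrable (fun x => f.toFun x * deriv φ x) := f.memLp_toFun.integrable_mul hd
    have i2 : Integrable (fun x => g.toFun x * deriv φ x) := g.memLp_toFun.integrable_mul hd
    have i3 : Integrable (fun x => f.wderiv x * φ x) := f.memLp_wderiv.integrable_mul h0
    have i4 : Integrable (fun x => g.wderiv x * φ x) := g.memLp_wderiv.integrable_mul h0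
    simp only [add_mul]
    rw [integral_add i1 i2, integral_add i3 i4, f.isWeakDeriv φ hφ hc, g.isWeakDeriv φ hφ hc]
    ring
  memLp_mul := by
    simp only [mul_add]
    exact f.memLp_mul.add g.memLp_mul

/-- A scalar multiple of an element of the form domain. -/
def smul (c : ℂ) (f : FormDomain) : FormDomain where
  toFun x := c * f.toFun x
  wderiv x := c * f.wderiv x
  continuous_toFun := continuous_const.mul f.continuous_toFun
  memLp_toFun := f.memLp_toFun.const_mul c
  memLp_wderiv := f.memLp_wderiv.const_mul c
  isWeakDeriv := by
    intro φ hφ hc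
    simp only [mul_assoc]
    rw [integral_const_mul, integral_const_mul, f.isWeakDeriv φ hφ hc]
    ring
  memLp_mul := by
    simp only [mul_left_comm _ c]
    exact f.memLp_mul.const_mul c

/-- A test function as an element of the form domain. -/
noncomputable def ofTest (φ : ℝ → ℂ) (hφ : ContDiff ℝ ∞ φ) (hc : HasCompactSupport φ) :
    FormDomain where
  toFun := φ
  wderiv := deriv φ
  continuous_toFun := hφ.continuous
  memLp_toFun := memLp_test hφ.continuous hc
  memLp_wderiv := memLp_test (hφ.continuous_deriv (by simp)) hc.deriv
  isWeakDeriv := by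
    intro ψ hψ hcψ
    have c1 := hφ.continuous_deriv (by simp)
    have c2 := hψ.continuous_deriv (by simp)
    refine integral_mul_deriv_eq_deriv_mul_of_integrable
      (fun x _ => (hφ.differentiable (by simp) x).hasDerivAt)
      (fun x _ => (hψ.differentiable (by simp) x).hasDerivAt) ?_ ?_ ?_
    · exact (hφ.continuous.mul c2).integrable_of_hasCompactSupport (hc.mul_right)
    · exact (c1.mul hψ.continuous).integrable_of_hasCompactSupport (hcψ.mul_left)
    · exact (hφ.continuous.mul hψ.continuous).integrable_of_hasCompactSupport (hc.mul_right)
  memLp_mul := memLp_test (Complex.continuous_ofReal.mul hφ.continuous) hc.mul_left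

end FormDomain

theorem pcForm_add (z : ℂ) (b : ℝ) (f f' g : FormDomain) :
    pcForm z b (f.add f') g = pcForm z b f g + pcForm z b f' g := by
  simp only [pcForm, FormDomain.add, mul_add]
  rw [l2Pairing_add f.memLp_wderiv f'.memLp_wderiv g.memLp_wderiv,
    l2Pairing_add f.memLp_mul f'.memLp_mul g.memLp_mul,
    l2Pairing_add f.memLp_toFun f'.memLp_toFun g.memLp_toFun]
  ring

theorem pcForm_smul (z : ℂ) (b : ℝ) (c : ℂ) (f g : FormDomain) :
    pcForm z b (f.smul c) g = c * pcForm z b f g := by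
  simp only [pcForm, FormDomain.smul, mul_left_comm _ c, l2Pairing_smul]
  ring

/-- The derivative component of an element of the form domain that vanishes is negligible. -/
theorem wderiv_ae_zero (f : FormDomain) (h : f.toFun =ᵐ[volume] 0) :
    f.wderiv =ᵐ[volume] 0 := by
  refine ae_eq_zero_of_integral_contDiff_smul_eq_zero
    (f.memLp_wderiv.locallyIntegrable (by norm_num)) ?_
  intro φ hφ hc
  have hψ : ContDiff ℝ ∞ (fun x => (φ x : ℂ)) := Complex.ofRealCLM.contDiff.comp hφ
  have hcψ : HasCompactSupport (fun x => (φ x : ℂ)) := hc.comp_left Complex.ofReal_zero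
  have key := f.isWeakDeriv _ hψ hcψ
  have h0 : ∫ x, f.toFun x * deriv (fun x => (φ x : ℂ)) x = 0 := by
    rw [← integral_zero ℝ ℂ]
    apply integral_congr_ae
    filter_upwards [h] with x hx
    simp [hx]
  rw [h0] at key
  have : ∫ x, φ x • f.wderiv x = ∫ x, f.wderiv x * (φ x : ℂ) := by
    congr 1; ext x; rw [Complex.real_smul, mul_comm]
  rw [this]
  exact neg_eq_zero.mp key.symm

/-! ### The operator -/

/-- The graph in `L²(ℝ) × L²(ℝ)` of the operator associated with the quadratic form: the pairs
`(u, v)` such that `u` lies in the form domain and the form at `(u, g)` is `⟨v, g⟩` for all `g`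
in the form domain. -/
noncomputable def pcGraph (z : ℂ) (b : ℝ) :
    Submodule ℂ (Lp ℂ 2 (volume : Measure ℝ) × Lp ℂ 2 (volume : Measure ℝ)) where
  carrier := {p | ∃ f : FormDomain, f.toFun =ᵐ[volume] p.1 ∧
    ∀ g : FormDomain, pcForm z b f g = l2Pairing p.2 g.toFun}
  add_mem' := by
    rintro p q ⟨f, hf, hfg⟩ ⟨f', hf', hfg'⟩
    refine ⟨f.add f', ?_, fun g => ?_⟩
    · filter_upwards [hf, hf', Lp.coeFn_add p.1 q.1] with x h1 h2 h3
      change f.toFun x + f'.toFun x = (p.1 + q.1 : Lp ℂ 2 (volume : Measure ℝ)) x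
      rw [h1, h2, h3, Pi.add_apply]
    · rw [pcForm_add, hfg, hfg', ← l2Pairing_add (Lp.memLp p.2) (Lp.memLp q.2) g.memLp_toFun]
      exact (l2Pairing_congr (Lp.coeFn_add p.2 q.2) _).symm
  zero_mem' := by
    let f : FormDomain := FormDomain.ofTest 0 contDiff_const HasCompactSupport.zero
    refine ⟨f.smul 0, ?_, fun g => ?_⟩
    · filter_upwards [Lp.coeFn_zero ℂ 2 (volume : Measure ℝ)] with x h
      change (0 : ℂ) * f.toFun x = (0 : Lp ℂ 2 (volume : Measure ℝ)) x
      rw [h, zero_mul, Pi.zero_apply]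
    · rw [pcForm_smul]
      have : l2Pairing ((0 : Lp ℂ 2 (volume : Measure ℝ)) : ℝ → ℂ) g.toFun = 0 := by
        rw [l2Pairing_congr (Lp.coeFn_zero ℂ 2 (volume : Measure ℝ))]
        simp [l2Pairing]
      simpa using this.symm
  smul_mem' := by
    rintro c p ⟨f, hf, hfg⟩
    refine ⟨f.smul c, ?_, fun g => ?_⟩
    · filter_upwards [hf, Lp.coeFn_smul c p.1] with x h1 h2
      change c * f.toFun x = (c • p.1 : Lp ℂ 2 (volume : Measure ℝ)) x
      rw [h1, h2, Pi.smul_apply, smul_eq_mul]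
    · rw [pcForm_smul, hfg, ← l2Pairing_smul]
      exact (l2Pairing_congr (Lp.coeFn_smul c p.2) _).symm

/-- The graph is single-valued. -/
theorem pcGraph_single (z : ℂ) (b : ℝ)
    (p : Lp ℂ 2 (volume : Measure ℝ) × Lp ℂ 2 (volume : Measure ℝ))
    (hp : p ∈ pcGraph z b) (h0 : p.1 = 0) : p.2 = 0 := by
  obtain ⟨f, hf, hfg⟩ := hp
  have hf0 : f.toFun =ᵐ[volume] 0 := by
    rw [h0] at hf
    exact hf.trans (Lp.coeFn_zero ℂ 2 (volume : Measure ℝ))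
  have hfun : f.toFun = 0 :=
    (f.continuous_toFun.ae_eq_iff_eq volume continuous_zero).mp hf0
  have hz : ∀ g : FormDomain, pcForm z b f g = 0 := by
    intro g
    simp only [pcForm, l2Pairing_congr (wderiv_ae_zero f hf0), hfun]
    simp [l2Pairing]
  have hae : ∀ᵐ x, (p.2 : ℝ → ℂ) x = 0 := by
    refine ae_eq_zero_of_integral_contDiff_smul_eq_zero
      ((Lp.memLp p.2).locallyIntegrable (by norm_num)) ?_
    intro φ hφ hc
    have hψ : ContDiff ℝ ∞ (fun x => (φ x : ℂ)) := Complex.ofRealCLM.contDiff.comp hφ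
    have hcψ : HasCompactSupport (fun x => (φ x : ℂ)) := hc.comp_left Complex.ofReal_zero
    have key := hfg (FormDomain.ofTest _ hψ hcψ)
    rw [hz] at key
    rw [key]
    simp only [l2Pairing, FormDomain.ofTest]
    congr 1; ext x; rw [Complex.real_smul, mul_comm, Complex.conj_ofReal]
  exact (Lp.eq_zero_iff_ae_eq_zero).mpr hae

/-- The operator `L_{z,b} = -d²/dx² + (x²/4 - 1/2) + z (δ(x - b) - δ(x + b))`, as the unbounded
operator on `L²(ℝ)` associated with its quadratic form. -/
noncomputable def pcOperator (z : ℂ) (b : ℝ) :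
    Lp ℂ 2 (volume : Measure ℝ) →ₗ.[ℂ] Lp ℂ 2 (volume : Measure ℝ) :=
  (pcGraph z b).toLinearPMap

theorem pcOperator_graph (z : ℂ) (b : ℝ) : (pcOperator z b).graph = pcGraph z b :=
  Submodule.toLinearPMap_graph_eq _ fun p hp h0 => pcGraph_single z b p hp h0

/-- `ν` is an eigenvalue of the unbounded operator `T`. -/
def IsEigenvalue {E : Type*} [AddCommGroup E] [Module ℂ E] (T : E →ₗ.[ℂ] E) (ν : ℂ) : Prop :=
  ∃ y : T.domain, (y : E) ≠ 0 ∧ T y = ν • (y : E)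

end PointHarmonic

/-! Write D for D_ν. Gluing a multiple of D(-x) to a multiple of D(x) at a point s gives a Green
function G_s that lies in the form domain and satisfies t_0(G_s, g) = ν⟨G_s, g⟩ + W(ν) conj(g(s)),
where W is the Wronskian (`pcForm_zero_weberGreen`). For f = p G_b + q G_{-b} the eigenvalue
equation therefore reduces to two linear equations in p and q. Their determinant vanishes exactly
when W² = z² D(b)² (D(-b)² - D(b)²), and a nontrivial solution gives an eigenfunction as long as W ≠
0 (`isEigenvalue_of_characteristic`).

For z = ir the condition reads F(ν) = -1/r², with F = D(b)² (D(-b)² - D(b)²) / W². Since λ is not a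
natural number, W(λ) ≠ 0; so F is analytic near λ, F(λ) = 0, and D_λ(-b) ≠ 0. F is not locally
constant, hence open at λ, and it takes the value -1/r² near λ once r is large
(`nhds_zero_le_map_characteristicFunction`). At real ν near λ one has F ≥ 0, so this solution is not
real (`characteristicFunction_re_nonneg`). The condition is invariant under conjugation, so the
conjugate is a second eigenvalue.

Two analytic inputs support this. Decay of D_ν at +∞ comes from an integral representation for re ν
< 0, carried to all ν by the three-term recurrence (`rapidDecay_parabolicD`). Integration by parts
against the form domain comes from showing that its elements are primitives of their weak
derivatives (`FormDomain.eq_add_integral`). -/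

namespace PointHarmonic

/-! ### The power series of the Weber equation -/

/-- The terms of the even (`a = 0`) and odd (`a = 1`) Weber series. -/
noncomputable def weberTerm (a : ℕ) (ν x : ℂ) (k : ℕ) : ℂ :=
  (∏ j ∈ Finset.range k, (-ν + a + 2 * (j : ℂ))) * x ^ (2 * k + a) / (Nat.factorial (2 * k + a) : ℂ)

/-- The even (`a = 0`) and odd (`a = 1`) Weber series. -/
noncomputable def weberSeries (a : ℕ) (ν x : ℂ) : ℂ := ∑' k, weberTerm a ν x k

theorem yEven_eq (ν x : ℂ) : yEven ν x = Complex.exp (-x ^ 2 / 4) * weberSeries 0 ν x := by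
  simp [yEven, weberSeries, weberTerm]

theorem yOdd_eq (ν x : ℂ) : yOdd ν x = Complex.exp (-x ^ 2 / 4) * weberSeries 1 ν x := by
  simp [yOdd, weberSeries, weberTerm]

/-- A majorant of the Weber series. -/
noncomputable def weberBound (a : ℕ) (R X : ℝ) (k : ℕ) : ℝ :=
  (∏ j ∈ Finset.range k, (R + 2 * (j : ℝ))) * X ^ (2 * k + a) / (Nat.factorial (2 * k + a) : ℝ)

theorem weberBound_succ (a : ℕ) (R X : ℝ) (k : ℕ) :
    weberBound a R X (k + 1) =
      (R + 2 * k) * X ^ 2 / ((2 * k + a + 1) * (2 * k + a + 2)) * weberBound a R X k := by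
  have h : 2 * (k + 1) + a = (2 * k + a) + 1 + 1 := by ring
  have h1 : (Nat.factorial (2 * k + a) : ℝ) ≠ 0 := by positivity
  have h2 : (2 * (k : ℝ) + a + 1) ≠ 0 := by positivity
  have h3 : (2 * (k : ℝ) + a + 2) ≠ 0 := by positivity
  have h4 : (2 * (k : ℝ) + a + 1 + 1) ≠ 0 := by positivity
  simp only [weberBound, Finset.prod_range_succ, h, Nat.factorial_succ]
  push_cast
  field_simp
  ring

/-- Ratio test: by `weberBound_succ` the ratio of consecutive terms is at most 1/2 once k ≥ R X². -/
theorem summable_weberBound (a : ℕ) {R X : ℝ} (hR : 1 ≤ R) (hX : 1 ≤ X) :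
    Summable (weberBound a R X) := by
  refine summable_of_ratio_norm_eventually_le (r := 1 / 2) (by norm_num) ?_
  obtain ⟨N, hN⟩ := exists_nat_ge (R * X ^ 2)
  filter_upwards [Filter.eventually_ge_atTop N] with k hk
  have hk' : R * X ^ 2 ≤ k := hN.trans (by exact_mod_cast hk)
  rw [weberBound_succ, norm_mul]
  refine mul_le_mul_of_nonneg_right ?_ (norm_nonneg _)
  have hR0 : 0 < R := by linarith
  rw [Real.norm_of_nonneg (by positivity), div_le_iff₀ (by positivity)]
  have hk0 : (0 : ℝ) ≤ k := by positivity
  have ha0 : (0 : ℝ) ≤ a := by positivity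
  have e1 : (R + 2 * k) * X ^ 2 ≤ (R * (2 * k + 1)) * X ^ 2 := by
    gcongr
    nlinarith
  have e2 : (R * X ^ 2) * (2 * k + 1) ≤ k * (2 * k + a + 1) := by
    apply mul_le_mul hk' (by linarith) (by positivity) hk0
  nlinarith [mul_nonneg hk0 ha0, mul_nonneg ha0 ha0]

/-- The bound is uniform over balls in ν and in x, so the series may be differentiated termwise in
either variable. -/
theorem norm_weberTerm_le {a : ℕ} {R X : ℝ} {ν x : ℂ} (hν : ‖ν‖ + a ≤ R) (hx : ‖x‖ ≤ X) (k : ℕ) :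
    ‖weberTerm a ν x k‖ ≤ weberBound a R X k := by
  unfold weberTerm weberBound
  rw [norm_div, norm_mul, norm_pow, norm_prod, Complex.norm_natCast]
  have hX : 0 ≤ X := (norm_nonneg x).trans hx
  have hR : 0 ≤ R := le_trans (by positivity) hν
  gcongr with j hj
  calc ‖-ν + a + 2 * (j : ℂ)‖ ≤ ‖-ν‖ + ‖(a : ℂ)‖ + ‖2 * (j : ℂ)‖ := norm_add₃_le
    _ ≤ R + 2 * j := by
      rw [norm_neg, Complex.norm_natCast, norm_mul, Complex.norm_natCast]
      simpa using hν

theorem summable_weberTerm (a : ℕ) (ν x : ℂ) : Summable (weberTerm a ν x) :=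
  Summable.of_norm_bounded
    (summable_weberBound a (R := ‖ν‖ + a + 1) (X := ‖x‖ + 1)
      (by have := norm_nonneg ν; linarith [Nat.cast_nonneg (α := ℝ) a])
      (by linarith [norm_nonneg x]))
    (norm_weberTerm_le (by linarith) (by linarith))

theorem differentiable_weberSeries_index (a : ℕ) (x : ℂ) :
    Differentiable ℂ fun ν => weberSeries a ν x := by
  intro ν
  have := Complex.differentiableOn_tsum_of_summable_norm (F := fun k μ => weberTerm a μ x k)
    (U := Metric.ball ν 1)
    (summable_weberBound a (R := ‖ν‖ + a + 1) (X := ‖x‖ + 1)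
      (by have := norm_nonneg ν; linarith [Nat.cast_nonneg (α := ℝ) a])
      (by linarith [norm_nonneg x]))
    (fun k => by unfold weberTerm; fun_prop) Metric.isOpen_ball
    (fun k μ hμ => norm_weberTerm_le (by
      have : ‖μ - ν‖ < 1 := by simpa [dist_eq_norm] using hμ
      have h2 : ‖μ‖ ≤ ‖μ - ν‖ + ‖ν‖ := by simpa using norm_add_le (μ - ν) ν
      linarith) (by linarith) k)
  exact this.differentiableAt (Metric.isOpen_ball.mem_nhds (by simp))

theorem hasDerivAt_weberTerm (a : ℕ) (ν x : ℂ) (k : ℕ) :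
    HasDerivAt (fun y => weberTerm a ν y k)
      ((∏ j ∈ Finset.range k, (-ν + a + 2 * (j : ℂ))) * ((2 * k + a : ℕ) * x ^ (2 * k + a - 1)) /
        (Nat.factorial (2 * k + a) : ℂ)) x :=
  ((hasDerivAt_pow (2 * k + a) x).const_mul _).div_const _

theorem hasDerivAt_weberSeries (a : ℕ) (ν x : ℂ) :
    HasDerivAt (fun y => weberSeries a ν y)
      (∑' k : ℕ, (∏ j ∈ Finset.range k, (-ν + a + 2 * (j : ℂ))) *
        ((2 * k + a : ℕ) * x ^ (2 * k + a - 1)) / (Nat.factorial (2 * k + a) : ℂ)) x ∧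
    Summable fun k : ℕ => (∏ j ∈ Finset.range k, (-ν + a + 2 * (j : ℂ))) *
        ((2 * k + a : ℕ) * x ^ (2 * k + a - 1)) / (Nat.factorial (2 * k + a) : ℂ) := by
  have hs := summable_weberBound a (R := ‖ν‖ + a + 1) (X := ‖x‖ + 1)
      (by have := norm_nonneg ν; linarith [Nat.cast_nonneg (α := ℝ) a])
      (by linarith [norm_nonneg x])
  have hd : ∀ k, DifferentiableOn ℂ (fun y => weberTerm a ν y k) (Metric.ball x 1) :=
    fun k => by unfold weberTerm; fun_prop
  have hb : ∀ (k : ℕ) (y : ℂ), y ∈ Metric.ball x 1 →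
      ‖weberTerm a ν y k‖ ≤ weberBound a (‖ν‖ + a + 1) (‖x‖ + 1) k :=
    fun k y hy => norm_weberTerm_le (by linarith) (by
      have : ‖y - x‖ < 1 := by simpa [dist_eq_norm] using hy
      have h2 : ‖y‖ ≤ ‖y - x‖ + ‖x‖ := by simpa using norm_add_le (y - x) x
      linarith) k
  have hx : x ∈ Metric.ball x 1 := by simp
  have h1 := Complex.differentiableOn_tsum_of_summable_norm hs hd Metric.isOpen_ball hb
  have h2 := Complex.hasSum_deriv_of_summable_norm hs hd Metric.isOpen_ball hb hx
  simp only [(hasDerivAt_weberTerm a ν x _).deriv] at h2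
  rw [h2.tsum_eq]
  exact ⟨(h1.differentiableAt (Metric.isOpen_ball.mem_nhds hx)).hasDerivAt, h2.summable⟩

/-- Differentiation lowers the power of x, and -ν + 1 = -(ν - 1) turns the odd coefficients at ν
into the even ones at ν - 1. -/
theorem hasDerivAt_weberSeries_one (ν x : ℂ) :
    HasDerivAt (fun y => weberSeries 1 ν y) (weberSeries 0 (ν - 1) x) x := by
  convert (hasDerivAt_weberSeries 1 ν x).1 using 1
  refine tsum_congr fun k => ?_
  simp only [weberTerm, Nat.factorial_succ]
  have h1 : (Nat.factorial (2 * k) : ℂ) ≠ 0 := by exact_mod_cast Nat.factorial_ne_zero _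
  have h2 : ((2 * k + 1 : ℕ) : ℂ) ≠ 0 := by exact_mod_cast Nat.succ_ne_zero (2 * k)
  have h3 : ∀ j : ℕ, -(ν - 1) + ((0 : ℕ) : ℂ) + 2 * (j : ℂ) = -ν + ((1 : ℕ) : ℂ) + 2 * (j : ℂ) :=
    fun j => by push_cast; ring
  simp only [h3, Nat.cast_mul (2 * k + 1), add_zero, Nat.add_sub_cancel]
  field_simp

/-- The constant term drops out; after reindexing, every remaining product contains the factor -ν
from j = 0. -/
theorem hasDerivAt_weberSeries_zero (ν x : ℂ) :
    HasDerivAt (fun y => weberSeries 0 ν y) (-ν * weberSeries 1 (ν - 1) x) x := by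
  obtain ⟨h, hs⟩ := hasDerivAt_weberSeries 0 ν x
  convert h using 1
  rw [hs.tsum_eq_zero_add, weberSeries, ← tsum_mul_left]
  simp only [mul_zero, zero_add, Nat.cast_zero, zero_mul, zero_div]
  refine tsum_congr fun k => ?_
  have e : 2 * (k + 1) + 0 = (2 * k + 1) + 1 := by ring
  simp only [weberTerm, e, Nat.factorial_succ (2 * k + 1), Finset.prod_range_succ']
  have h1 : (Nat.factorial (2 * k + 1) : ℂ) ≠ 0 := by exact_mod_cast Nat.factorial_ne_zero _
  have h2 : ((2 * k + 1 + 1 : ℕ) : ℂ) ≠ 0 := by exact_mod_cast Nat.succ_ne_zero (2 * k + 1)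
  have h3 : ∀ j : ℕ, -(ν - 1) + ((1 : ℕ) : ℂ) + 2 * (j : ℂ) =
    -ν + 0 + 2 * ((j + 1 : ℕ) : ℂ) := fun j => by push_cast; ring
  simp only [h3, Nat.cast_mul (2 * k + 1 + 1), Nat.add_sub_cancel]
  field_simp
  push_cast
  ring

/-- Both sides are the product of c + 2j over 0 ≤ j ≤ k. This is the only identity between
coefficients that the contiguous relations need. -/
theorem prod_shift_index (c : ℂ) (k : ℕ) :
    (∏ j ∈ Finset.range k, (c + 2 + 2 * (j : ℂ))) * c =
      (∏ j ∈ Finset.range k, (c + 2 * (j : ℂ))) * (c + 2 * k) := by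
  rw [← Finset.prod_range_succ (fun j : ℕ => c + 2 * (j : ℂ)), Finset.prod_range_succ']
  simp only [Nat.cast_zero, mul_zero, add_zero]
  congr 1
  refine Finset.prod_congr rfl fun j _ => ?_
  push_cast
  ring

theorem weberSeries_one_contiguous (ν x : ℂ) :
    (ν + 1) * weberSeries 1 (ν + 1) x =
      x * weberSeries 0 ν x + ν * weberSeries 1 (ν - 1) x := by
  simp only [weberSeries, ← tsum_mul_left]
  rw [← ((summable_weberTerm 0 ν x).mul_left x).tsum_add
    ((summable_weberTerm 1 (ν - 1) x).mul_left ν)]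
  refine tsum_congr fun k => ?_
  have h1 : (Nat.factorial (2 * k) : ℂ) ≠ 0 := by exact_mod_cast Nat.factorial_ne_zero _
  have h2 : (2 * (k : ℂ) + 1) ≠ 0 := by exact_mod_cast Nat.succ_ne_zero (2 * k)
  have key := prod_shift_index (-ν) k
  have e1 : ∀ j : ℕ, -(ν + 1) + ((1 : ℕ) : ℂ) + 2 * (j : ℂ) = -ν + 2 * (j : ℂ) :=
    fun j => by push_cast; ring
  have e2 : ∀ j : ℕ, -(ν - 1) + ((1 : ℕ) : ℂ) + 2 * (j : ℂ) = -ν + 2 + 2 * (j : ℂ) :=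
    fun j => by push_cast; ring
  simp only [weberTerm, e1, e2, Nat.factorial_succ, Nat.cast_zero, add_zero, Nat.cast_mul]
  push_cast
  field_simp
  linear_combination x ^ (2 * k + 1) * key

theorem weberSeries_zero_contiguous (ν x : ℂ) :
    weberSeries 0 (ν - 1) x = weberSeries 0 (ν + 1) x + x * weberSeries 1 ν x := by
  simp only [weberSeries]
  rw [(summable_weberTerm 0 (ν - 1) x).tsum_eq_zero_add,
    (summable_weberTerm 0 (ν + 1) x).tsum_eq_zero_add, ← tsum_mul_left, add_assoc,
    ← ((summable_nat_add_iff 1).mpr (summable_weberTerm 0 (ν + 1) x)).tsum_add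
    ((summable_weberTerm 1 ν x).mul_left x)]
  congr 1
  refine tsum_congr fun k => ?_
  have h1 : (Nat.factorial (2 * k + 1) : ℂ) ≠ 0 := by exact_mod_cast Nat.factorial_ne_zero _
  have h2 : (2 * (k : ℂ) + 1 + 1) ≠ 0 := by exact_mod_cast Nat.succ_ne_zero (2 * k + 1)
  have e : 2 * (k + 1) + 0 = (2 * k + 1) + 1 := by ring
  have key := prod_shift_index (-(ν + 1)) k
  have e1 : ∀ j : ℕ, -(ν - 1) + 2 * (j : ℂ) = -(ν + 1) + 2 + 2 * (j : ℂ) :=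
    fun j => by ring
  have e2 : ∀ j : ℕ, -ν + ((1 : ℕ) : ℂ) + 2 * (j : ℂ) = -(ν + 1) + 2 + 2 * (j : ℂ) :=
    fun j => by push_cast; ring
  simp only [weberTerm, e1, e2, e, Nat.factorial_succ (2 * k + 1), Nat.cast_zero, add_zero,
    Nat.cast_mul, Finset.prod_range_succ]
  push_cast at key ⊢
  field_simp
  linear_combination x ^ (2 * k + 2) * key

theorem weberSeries_conj (a : ℕ) (ν x : ℂ) :
    weberSeries a (conj ν) (conj x) = conj (weberSeries a ν x) := by
  simp [weberSeries, weberTerm, Complex.conj_tsum, map_ofNat]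

theorem weberSeries_zero_zero (x : ℂ) : weberSeries 0 0 x = 1 := by
  rw [weberSeries, tsum_eq_single 0]
  · simp [weberTerm]
  · intro k hk
    obtain ⟨n, rfl⟩ := Nat.exists_eq_succ_of_ne_zero hk
    simp [weberTerm, Finset.prod_range_succ']

theorem weberSeries_apply_zero (ν : ℂ) : weberSeries 0 ν 0 = 1 := by
  rw [weberSeries, tsum_eq_single 0]
  · simp [weberTerm]
  · intro k hk
    simp [weberTerm, hk]

theorem weberSeries_one_apply_zero (ν : ℂ) : weberSeries 1 ν 0 = 0 := by
  simp [weberSeries, weberTerm]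

/-! ### The parabolic cylinder function: recurrences, differential equation, Wronskian -/

/-- The value of the parabolic cylinder function at the origin. -/
noncomputable def evenCoeff (ν : ℂ) : ℂ :=
  (2 : ℂ) ^ (ν / 2) * (Real.sqrt Real.pi : ℂ) * (Complex.Gamma (-ν / 2 + 1 / 2))⁻¹

/-- Minus the derivative of the parabolic cylinder function at the origin. -/
noncomputable def oddCoeff (ν : ℂ) : ℂ :=
  (2 : ℂ) ^ ((ν + 1) / 2) * (Real.sqrt Real.pi : ℂ) * (Complex.Gamma (-ν / 2))⁻¹

theorem parabolicD_eq (ν x : ℂ) : parabolicD ν x = Complex.exp (-x ^ 2 / 4) *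
    (evenCoeff ν * weberSeries 0 ν x - oddCoeff ν * weberSeries 1 ν x) := by
  rw [parabolicD, yEven_eq, yOdd_eq, evenCoeff, oddCoeff]
  ring

theorem oddCoeff_sub_one (ν : ℂ) : oddCoeff (ν - 1) = evenCoeff ν := by
  rw [oddCoeff, evenCoeff]
  congr 3 <;> ring

/-- The functional equation of Γ, in the reciprocal form that holds at the poles too. -/
theorem oddCoeff_eq (ν : ℂ) : oddCoeff ν = -ν * evenCoeff (ν - 1) := by
  rw [oddCoeff, evenCoeff, Complex.one_div_Gamma_eq_self_mul_one_div_Gamma_add_one]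
  have h1 : -(ν - 1) / 2 + 1 / 2 = -ν / 2 + 1 := by ring
  have h2 : (2 : ℂ) ^ ((ν + 1) / 2) = 2 * (2 : ℂ) ^ ((ν - 1) / 2) := by
    rw [show (ν + 1) / 2 = 1 + (ν - 1) / 2 by ring, Complex.cpow_add _ _ two_ne_zero,
      Complex.cpow_one]
  rw [h1, h2]
  ring

/-- The three-term recurrence. It yields the Weber equation from the first-order derivative formula
and extends decay from re ν < 0 to every ν. -/
theorem parabolicD_add_one (ν x : ℂ) :
    parabolicD (ν + 1) x = x * parabolicD ν x - ν * parabolicD (ν - 1) x := by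
  have h1 : oddCoeff ν = evenCoeff (ν + 1) := by simpa using oddCoeff_sub_one (ν + 1)
  have h2 : oddCoeff (ν + 1) = -(ν + 1) * evenCoeff ν := by simpa using oddCoeff_eq (ν + 1)
  simp only [parabolicD_eq, h2, oddCoeff_sub_one]
  have h3 := oddCoeff_eq ν
  rw [h1] at h3 ⊢
  have s0 := weberSeries_zero_contiguous ν x
  have s1 := weberSeries_one_contiguous ν x
  linear_combination Complex.exp (-x ^ 2 / 4) * (evenCoeff ν * s1 - evenCoeff (ν + 1) * s0 +
    weberSeries 0 (ν - 1) x * h3)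

/-- The derivative of the parabolic cylinder function. -/
noncomputable def parabolicDDeriv (ν x : ℂ) : ℂ :=
  ν * parabolicD (ν - 1) x - x / 2 * parabolicD ν x

theorem hasDerivAt_parabolicD (ν x : ℂ) :
    HasDerivAt (parabolicD ν) (parabolicDDeriv ν x) x := by
  have he : HasDerivAt (fun y : ℂ => Complex.exp (-y ^ 2 / 4))
      (Complex.exp (-x ^ 2 / 4) * (-x / 2)) x := by
    convert! ((hasDerivAt_pow 2 x).neg.div_const 4).cexp using 1
    simp only [Pi.neg_apply]
    push_cast
    ring
  have h := he.mul (((hasDerivAt_weberSeries_zero ν x).const_mul (evenCoeff ν)).sub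
    ((hasDerivAt_weberSeries_one ν x).const_mul (oddCoeff ν)))
  convert! h using 1
  · funext y
    exact parabolicD_eq ν y
  · simp only [parabolicDDeriv, parabolicD_eq, oddCoeff_sub_one, Pi.sub_apply]
    linear_combination Complex.exp (-x ^ 2 / 4) * weberSeries 0 (ν - 1) x * (oddCoeff_eq ν)

/-- The Weber equation. -/
theorem hasDerivAt_parabolicDDeriv (ν x : ℂ) :
    HasDerivAt (parabolicDDeriv ν) ((x ^ 2 / 4 - 1 / 2 - ν) * parabolicD ν x) x := by
  have h := ((hasDerivAt_parabolicD (ν - 1) x).const_mul ν).sub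
    (((hasDerivAt_id x).div_const 2).mul (hasDerivAt_parabolicD ν x))
  convert! h using 1
  have e := parabolicD_add_one (ν - 1) x
  rw [sub_add_cancel] at e
  simp only [parabolicDDeriv, id]
  linear_combination (-ν) * e

theorem differentiable_parabolicDDeriv (ν : ℂ) : Differentiable ℂ (parabolicDDeriv ν) :=
  fun x => (hasDerivAt_parabolicDDeriv ν x).differentiableAt

/-- The Wronskian of `D_ν(-x)` and `D_ν(x)`. -/
noncomputable def weberWronskian (ν : ℂ) : ℂ := 2 * evenCoeff ν * oddCoeff ν

/-- D(x) and D(-x) solve the same equation without first-order term, so the Wronskian is constant in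
x; its value is read off at x = 0. -/
theorem wronskian_eq (ν x : ℂ) :
    -(parabolicD ν x * parabolicDDeriv ν (-x) + parabolicDDeriv ν x * parabolicD ν (-x)) =
      weberWronskian ν := by
  have hd : ∀ x : ℂ, HasDerivAt (fun x => -(parabolicD ν x * parabolicDDeriv ν (-x) +
      parabolicDDeriv ν x * parabolicD ν (-x))) 0 x := by
    intro x
    have n := hasDerivAt_neg x
    have h1 := (hasDerivAt_parabolicD ν (-x)).comp x n
    have h2 := (hasDerivAt_parabolicDDeriv ν (-x)).comp x n
    convert! (((hasDerivAt_parabolicD ν x).mul h2).add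
      ((hasDerivAt_parabolicDDeriv ν x).mul h1)).neg using 1
    simp only [Function.comp]
    ring
  have hc := is_const_of_deriv_eq_zero (fun x => (hd x).differentiableAt) (fun x => (hd x).deriv) x 0
  refine hc.trans ?_
  have e := oddCoeff_eq ν
  simp only [neg_zero, parabolicDDeriv, parabolicD_eq, weberSeries_apply_zero,
    weberSeries_one_apply_zero, weberWronskian]
  simp
  linear_combination (-2) * evenCoeff ν * e

/-! ### Entire dependence on the index, and zeros of the Wronskian. -/

theorem differentiable_evenCoeff : Differentiable ℂ evenCoeff := by
  have h : Differentiable ℂ fun ν : ℂ => (Complex.Gamma (-ν / 2 + 1 / 2))⁻¹ :=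
    Complex.differentiable_one_div_Gamma.comp (by fun_prop)
  have h2 : Differentiable ℂ fun ν : ℂ => (2 : ℂ) ^ (ν / 2) := fun ν =>
    DifferentiableAt.const_cpow (by fun_prop) (Or.inl two_ne_zero)
  exact (h2.mul_const _).mul h

theorem differentiable_oddCoeff : Differentiable ℂ oddCoeff := by
  have h : oddCoeff = fun ν => -ν * evenCoeff (ν - 1) := funext oddCoeff_eq
  rw [h]
  exact differentiable_neg.mul (differentiable_evenCoeff.comp (by fun_prop))

theorem differentiable_weberWronskian : Differentiable ℂ weberWronskian :=
  (differentiable_evenCoeff.const_mul 2).mul differentiable_oddCoeff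

theorem differentiable_parabolicD_index (x : ℂ) : Differentiable ℂ fun ν => parabolicD ν x := by
  simp only [parabolicD_eq]
  exact ((differentiable_evenCoeff.mul (differentiable_weberSeries_index 0 x)).sub
    (differentiable_oddCoeff.mul (differentiable_weberSeries_index 1 x))).const_mul _

/-- The Wronskian vanishes only at poles of the two Gamma factors; these are the odd naturals for
the even coefficient and the even naturals for the odd one. -/
theorem weberWronskian_ne_zero {ν : ℂ} (hν : ∀ n : ℕ, ν ≠ n) : weberWronskian ν ≠ 0 := by
  have hp : (Real.sqrt Real.pi : ℂ) ≠ 0 := by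
    exact_mod_cast (Real.sqrt_pos.mpr Real.pi_pos).ne'
  have h2 : ∀ s : ℂ, (2 : ℂ) ^ s ≠ 0 := fun s => by simp [Complex.cpow_eq_zero_iff]
  have g1 : Complex.Gamma (-ν / 2 + 1 / 2) ≠ 0 := Complex.Gamma_ne_zero fun m h => by
    refine hν (2 * m + 1) ?_
    push_cast
    linear_combination (-2) * h
  have g2 : Complex.Gamma (-ν / 2) ≠ 0 := Complex.Gamma_ne_zero fun m h => by
    refine hν (2 * m) ?_
    push_cast
    linear_combination (-2) * h
  exact mul_ne_zero (mul_ne_zero two_ne_zero (mul_ne_zero (mul_ne_zero (h2 _) hp) (inv_ne_zero g1)))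
    (mul_ne_zero (mul_ne_zero (h2 _) hp) (inv_ne_zero g2))

/-! ### Symmetry under complex conjugation. -/

theorem conj_two_cpow (s : ℂ) : (2 : ℂ) ^ conj s = conj ((2 : ℂ) ^ s) := by
  have : (2 : ℂ).arg ≠ Real.pi := by
    rw [show (2 : ℂ) = ((2 : ℝ) : ℂ) by simp, Complex.arg_ofReal_of_nonneg (by norm_num)]
    exact Real.pi_pos.ne
  have h := Complex.cpow_conj 2 s this
  simpa [map_ofNat] using h

theorem evenCoeff_conj (ν : ℂ) : evenCoeff (conj ν) = conj (evenCoeff ν) := by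
  simp only [evenCoeff, map_mul, map_inv₀, Complex.conj_ofReal, ← conj_two_cpow,
    ← Complex.Gamma_conj]
  simp [map_ofNat]

theorem oddCoeff_conj (ν : ℂ) : oddCoeff (conj ν) = conj (oddCoeff ν) := by
  have : conj ν - 1 = conj (ν - 1) := by simp
  rw [oddCoeff_eq, oddCoeff_eq, this, evenCoeff_conj]
  simp

theorem weberWronskian_conj (ν : ℂ) : weberWronskian (conj ν) = conj (weberWronskian ν) := by
  simp [weberWronskian, evenCoeff_conj, oddCoeff_conj, map_ofNat]

theorem parabolicD_conj (ν : ℂ) (x : ℝ) :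
    parabolicD (conj ν) x = conj (parabolicD ν x) := by
  have h : ∀ a, weberSeries a (conj ν) x = conj (weberSeries a ν x) := fun a => by
    rw [← weberSeries_conj, Complex.conj_ofReal]
  simp [parabolicD_eq, h, evenCoeff_conj, oddCoeff_conj, ← Complex.exp_conj, map_ofNat]

/-- D_0 is a nonzero multiple of a Gaussian. This shows that ν ↦ D_ν(b) is not identically zero. -/
theorem parabolicD_zero_ne_zero (x : ℂ) : parabolicD 0 x ≠ 0 := by
  have h : oddCoeff 0 = 0 := by simp [oddCoeff_eq]
  rw [parabolicD_eq, h, weberSeries_zero_zero, evenCoeff]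
  have hp : (Real.sqrt Real.pi : ℂ) ≠ 0 := by
    exact_mod_cast (Real.sqrt_pos.mpr Real.pi_pos).ne'
  have g : Complex.Gamma (1 / 2) ≠ 0 := Complex.Gamma_ne_zero_of_re_pos (by norm_num)
  simpa [Complex.exp_ne_zero, Real.pi_ne_zero] using And.intro (by exact_mod_cast hp) g

/-! ### Integral representation and decay -/

/-- Euler's integral for Γ(s/2) after a quadratic substitution. -/
theorem integral_cpow_mul_gaussian {s : ℂ} (hs : 0 < s.re) :
    ∫ t in Set.Ioi (0 : ℝ), (t : ℂ) ^ (s - 1) * Complex.exp (-(t : ℂ) ^ 2 / 2) =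
      (2 : ℂ) ^ (s / 2) / 2 * Complex.Gamma (s / 2) := by
  have h := mellin_comp_rpow (fun t : ℝ => Complex.exp (-(((1 / 2 : ℝ) : ℂ) * t))) s 2
  have h2 : 0 < (s / 2).re := by simpa using hs
  have h3 := Complex.integral_cpow_mul_exp_neg_mul_Ioi h2 (r := 1 / 2) (by norm_num)
  simp only [mellin, smul_eq_mul] at h
  rw [show s / ((2 : ℝ) : ℂ) = s / 2 by simp, h3] at h
  have e : ∀ t : ℝ, Complex.exp (-(((1 / 2 : ℝ) : ℂ) * ((t ^ (2 : ℝ) : ℝ) : ℂ))) =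
      Complex.exp (-(t : ℂ) ^ 2 / 2) := fun t => by
    rw [Real.rpow_two]
    congr 1
    push_cast
    ring
  simp only [e] at h
  rw [h]
  have h4 : (1 : ℂ) / ((1 / 2 : ℝ) : ℂ) = 2 := by norm_num
  rw [h4]
  simp
  ring

theorem integrableOn_rpow_mul_exp_linear {σ : ℝ} (hσ : 0 < σ) (y : ℝ) :
    IntegrableOn (fun t : ℝ => t ^ (σ - 1) * Real.exp (-t ^ 2 / 2) * Real.exp (y * t))
      (Set.Ioi 0) := by
  have h := (integrableOn_rpow_mul_exp_neg_mul_sq (b := 1 / 4) (by norm_num)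
    (s := σ - 1) (by linarith)).mul_const (Real.exp (y ^ 2))
  refine Integrable.mono' h ?_ ?_
  · refine ContinuousOn.aestronglyMeasurable ?_ measurableSet_Ioi
    refine ((ContinuousOn.rpow_const continuousOn_id fun t ht => Or.inl (ne_of_gt ht)).mul
      (by fun_prop)).mul (by fun_prop)
  · filter_upwards [ae_restrict_mem measurableSet_Ioi] with t ht
    have ht0 : (0 : ℝ) < t := ht
    rw [Real.norm_of_nonneg (by positivity), mul_assoc, mul_assoc, ← Real.exp_add, ← Real.exp_add]
    refine mul_le_mul_of_nonneg_left (Real.exp_le_exp.mpr ?_) (by positivity)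
    -- Completing the square: yt ≤ y² + t²/4, so half of the Gaussian exponent survives.
    nlinarith [sq_nonneg (y - t / 2)]

/-- Expand e^{-xt} and integrate termwise; the absolute values of the terms sum to e^{|x|t}, which
the Gaussian dominates. -/
theorem hasSum_weber_moments {ν : ℂ} (hν : ν.re < 0) (x : ℝ) :
    HasSum (fun n : ℕ => (-(x : ℂ)) ^ n / (n.factorial : ℂ) *
        ((2 : ℂ) ^ ((n - ν) / 2) / 2 * Complex.Gamma ((n - ν) / 2)))
      (∫ t in Set.Ioi (0 : ℝ), (t : ℂ) ^ (-ν - 1) * Complex.exp (-(t : ℂ) ^ 2 / 2) *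
        Complex.exp (-x * t)) := by
  have hm : ∀ n : ℕ, (-(x : ℂ)) ^ n / (n.factorial : ℂ) *
        ((2 : ℂ) ^ ((n - ν) / 2) / 2 * Complex.Gamma ((n - ν) / 2)) =
      ∫ t in Set.Ioi (0 : ℝ), (-(x : ℂ)) ^ n / (n.factorial : ℂ) *
        ((t : ℂ) ^ (n - ν - 1) * Complex.exp (-(t : ℂ) ^ 2 / 2)) := fun n => by
    rw [integral_const_mul, integral_cpow_mul_gaussian]
    simp only [Complex.sub_re, Complex.natCast_re]
    have : (0 : ℝ) ≤ n := by positivity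
    linarith
  have hF : ∀ n : ℕ, ∀ t : ℝ, 0 < t → (-(x : ℂ)) ^ n / (n.factorial : ℂ) *
        ((t : ℂ) ^ (n - ν - 1) * Complex.exp (-(t : ℂ) ^ 2 / 2)) =
      (t : ℂ) ^ (-ν - 1) * Complex.exp (-(t : ℂ) ^ 2 / 2) * ((-x * t) ^ n / n.factorial) :=
    fun n t ht => by
    have : (t : ℂ) ≠ 0 := by exact_mod_cast ht.ne'
    rw [show (n : ℂ) - ν - 1 = (-ν - 1) + n by ring, Complex.cpow_add _ _ this,
      Complex.cpow_natCast, mul_pow]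
    ring
  have hexp : ∀ z : ℂ, HasSum (fun n : ℕ => z ^ n / n.factorial) (Complex.exp z) := fun z => by
    rw [Complex.exp_eq_exp_ℂ]
    exact NormedSpace.expSeries_div_hasSum_exp z
  have hrexp : ∀ z : ℝ, HasSum (fun n : ℕ => z ^ n / n.factorial) (Real.exp z) := fun z => by
    rw [Real.exp_eq_exp_ℝ]
    exact NormedSpace.expSeries_div_hasSum_exp z
  simp only [hm]
  refine hasSum_integral_of_dominated_convergence
    (fun n t => t ^ (-ν.re - 1) * Real.exp (-t ^ 2 / 2) * ((|x| * t) ^ n / n.factorial))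
    (fun n => ?_) (fun n => ?_) ?_ ?_ ?_
  · refine ContinuousOn.aestronglyMeasurable ?_ measurableSet_Ioi
    refine continuousOn_const.mul (ContinuousOn.mul ?_ (by fun_prop))
    intro t ht
    exact (Complex.continuousAt_ofReal_cpow_const t _ (Or.inr (ne_of_gt ht))).continuousWithinAt
  · filter_upwards [ae_restrict_mem measurableSet_Ioi] with t ht
    have ht0 : (0 : ℝ) < t := ht
    rw [hF n t ht, norm_mul, norm_mul, Complex.norm_cpow_eq_rpow_re_of_pos ht0, Complex.norm_exp,
      norm_div, norm_pow, norm_mul, norm_neg, Complex.norm_natCast, Complex.norm_real,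
      Complex.norm_real, Real.norm_eq_abs, Real.norm_eq_abs, abs_of_pos ht0]
    have : (-(t : ℂ) ^ 2 / 2).re = -t ^ 2 / 2 := by
      rw [show (-(t : ℂ) ^ 2 / 2) = ((-t ^ 2 / 2 : ℝ) : ℂ) by push_cast; rfl, Complex.ofReal_re]
    rw [this]
    simp
  · exact ae_of_all _ fun t => ((hrexp _).summable.mul_left _)
  · simp only [tsum_mul_left, (hrexp _).tsum_eq]
    exact integrableOn_rpow_mul_exp_linear (by linarith) |x|
  · filter_upwards [ae_restrict_mem measurableSet_Ioi] with t ht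
    simp only [hF _ t ht]
    exact (hexp _).mul_left _

theorem two_cpow_mul_Gamma_add_nat {s : ℂ} (hs : 0 < s.re) (k : ℕ) :
    (2 : ℂ) ^ (s + k) * Complex.Gamma (s + k) =
      (2 : ℂ) ^ s * Complex.Gamma s * ∏ j ∈ Finset.range k, (2 * s + 2 * (j : ℂ)) := by
  induction k with
  | zero => simp
  | succ k ih =>
    have h0 : s + k ≠ 0 := fun h => by
      have h1 := congrArg Complex.re h
      simp only [Complex.add_re, Complex.natCast_re, Complex.zero_re] at h1
      have : (0 : ℝ) ≤ k := by positivity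
      linarith
    rw [Finset.prod_range_succ, Nat.cast_succ, ← add_assoc, Complex.Gamma_add_one _ h0,
      Complex.cpow_add _ _ two_ne_zero, Complex.cpow_one]
    linear_combination (2 * (s + k)) * ih

/-- For `re ν < 0` the parabolic cylinder function is a multiple of
`e^{-x²/4} ∫₀^∞ t^{-ν-1} e^{-t²/2 - x t} dt`. -/
theorem parabolicD_integral {ν : ℂ} (hν : ν.re < 0) : ∃ K : ℂ, ∀ x : ℝ,
    parabolicD ν x = K * Complex.exp (-(x : ℂ) ^ 2 / 4) *
      ∫ t in Set.Ioi (0 : ℝ), (t : ℂ) ^ (-ν - 1) * Complex.exp (-(t : ℂ) ^ 2 / 2) *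
        Complex.exp (-x * t) := by
  have r0 : 0 < (-ν / 2).re := by
    rw [show -ν / 2 = ((1 / 2 : ℝ) : ℂ) * (-ν) by push_cast; ring, Complex.re_ofReal_mul,
      Complex.neg_re]
    linarith
  have r1 : 0 < (-ν / 2 + 1 / 2).re := by
    rw [Complex.add_re]
    have : ((1 : ℂ) / 2).re = 1 / 2 := by norm_num
    linarith
  -- A and B are the moments of order 0 and 1. Every other moment follows from the one of its parity
  -- by the functional equation of Γ, so even n sum to the even Weber series and odd n to the odd
  -- one.
  set A : ℂ := (2 : ℂ) ^ (-ν / 2) / 2 * Complex.Gamma (-ν / 2) with hA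
  set B : ℂ := (2 : ℂ) ^ (-ν / 2 + 1 / 2) / 2 * Complex.Gamma (-ν / 2 + 1 / 2) with hB
  have hint : ∀ x : ℝ, ∫ t in Set.Ioi (0 : ℝ), (t : ℂ) ^ (-ν - 1) *
      Complex.exp (-(t : ℂ) ^ 2 / 2) * Complex.exp (-x * t) =
      A * weberSeries 0 ν x - B * weberSeries 1 ν x := fun x => by
    refine (hasSum_weber_moments hν x).unique ?_
    rw [sub_eq_add_neg, ← neg_mul]
    refine HasSum.even_add_odd ?_ ?_
    · convert! (summable_weberTerm 0 ν x).hasSum.mul_left A using 1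
      funext k
      have := two_cpow_mul_Gamma_add_nat r0 k
      rw [show (((2 * k : ℕ) : ℂ) - ν) / 2 = -ν / 2 + k by push_cast; ring]
      have e : ∀ j : ℕ, 2 * (-ν / 2) + 2 * (j : ℂ) = -ν + 2 * j := fun j => by ring
      simp only [e] at this
      simp only [weberTerm, Nat.cast_zero, add_zero, hA, pow_mul, neg_sq]
      linear_combination ((x : ℂ) ^ 2) ^ k / ((2 * k).factorial : ℂ) / 2 * this
    · convert! (summable_weberTerm 1 ν x).hasSum.mul_left (-B) using 1
      funext k
      have := two_cpow_mul_Gamma_add_nat r1 k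
      rw [show (((2 * k + 1 : ℕ) : ℂ) - ν) / 2 = -ν / 2 + 1 / 2 + k by push_cast; ring]
      have e : ∀ j : ℕ, 2 * (-ν / 2 + 1 / 2) + 2 * (j : ℂ) = -ν + 1 + 2 * j := fun j => by ring
      simp only [e] at this
      simp only [weberTerm, Nat.cast_one, hB, pow_succ, pow_mul]
      linear_combination ((x : ℂ) ^ 2) ^ k * (-x) / ((2 * k + 1).factorial : ℂ) / 2 * this
  have g0 : Complex.Gamma (-ν / 2) ≠ 0 := Complex.Gamma_ne_zero_of_re_pos r0
  have g1 : Complex.Gamma (-ν / 2 + 1 / 2) ≠ 0 := Complex.Gamma_ne_zero_of_re_pos r1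
  have p2 : ∀ s : ℂ, (2 : ℂ) ^ s ≠ 0 := fun s => by simp [Complex.cpow_eq_zero_iff]
  have hA0 : A ≠ 0 := mul_ne_zero (div_ne_zero (p2 _) two_ne_zero) g0
  -- The integral and D_ν combine the two series in the same ratio, so they are proportional.
  have hcd : evenCoeff ν * B = oddCoeff ν * A := by
    have e1 : (2 : ℂ) ^ (ν / 2) * (2 : ℂ) ^ (-ν / 2 + 1 / 2) =
        (2 : ℂ) ^ ((ν + 1) / 2) * (2 : ℂ) ^ (-ν / 2) := by
      rw [← Complex.cpow_add _ _ two_ne_zero, ← Complex.cpow_add _ _ two_ne_zero]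
      congr 1
      ring
    rw [hA, hB, evenCoeff, oddCoeff]
    linear_combination (Real.sqrt Real.pi : ℂ) / 2 * e1 +
      (Real.sqrt Real.pi : ℂ) / 2 * (2 : ℂ) ^ (ν / 2) * (2 : ℂ) ^ (-ν / 2 + 1 / 2) *
        inv_mul_cancel₀ g1 - (Real.sqrt Real.pi : ℂ) / 2 * (2 : ℂ) ^ ((ν + 1) / 2) *
        (2 : ℂ) ^ (-ν / 2) * inv_mul_cancel₀ g0
  refine ⟨evenCoeff ν / A, fun x => ?_⟩
  rw [hint, parabolicD_eq]
  clear_value A B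
  field_simp
  linear_combination weberSeries 1 ν x * hcd

/-- Decay at `+∞`, together with all polynomial multiples. -/
def RapidDecay (f : ℝ → ℂ) : Prop :=
  ∀ k : ℕ, (fun x : ℝ => (x : ℂ) ^ k * f x) =O[Filter.atTop] fun x : ℝ => Real.exp (-1 * x)

theorem RapidDecay.sub {f g : ℝ → ℂ} (hf : RapidDecay f) (hg : RapidDecay g) :
    RapidDecay fun x => f x - g x := fun k => by
  simpa only [mul_sub] using (hf k).sub (hg k)

theorem RapidDecay.const_mul {f : ℝ → ℂ} (hf : RapidDecay f) (c : ℂ) :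
    RapidDecay fun x => c * f x := fun k => by
  simpa only [mul_left_comm _ c] using (hf k).const_mul_left c

theorem RapidDecay.id_mul {f : ℝ → ℂ} (hf : RapidDecay f) :
    RapidDecay fun x => (x : ℂ) * f x := fun k => by
  simpa only [pow_succ, mul_assoc] using hf (k + 1)

/-- For x ≥ 0 the integral is bounded independently of x, so the Gaussian prefactor controls the
decay. It is weakened to a multiple of e^{-2x}, leaving a spare e^{-x} to absorb x^k. -/
theorem rapidDecay_parabolicD_of_re_neg {ν : ℂ} (hν : ν.re < 0) :
    RapidDecay fun x => parabolicD ν x := by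
  obtain ⟨K, hK⟩ := parabolicD_integral hν
  set C : ℝ := ∫ t in Set.Ioi (0 : ℝ), t ^ (-ν.re - 1) * Real.exp (-t ^ 2 / 2)
  have hi := integrableOn_rpow_mul_exp_linear (σ := -ν.re) (by linarith) 0
  simp only [zero_mul, Real.exp_zero, mul_one] at hi
  have hre : ∀ (x c : ℝ), (-(x : ℂ) ^ 2 / c).re = -x ^ 2 / c := fun x c => by
    rw [show (-(x : ℂ) ^ 2 / c) = ((-x ^ 2 / c : ℝ) : ℂ) by push_cast; rfl, Complex.ofReal_re]
  have hb : ∀ x : ℝ, 0 ≤ x → ‖parabolicD ν x‖ ≤ ‖K‖ * C * Real.exp 4 * Real.exp (-2 * x) := by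
    intro x hx
    have h1 : ‖∫ t in Set.Ioi (0 : ℝ), (t : ℂ) ^ (-ν - 1) *
        Complex.exp (-(t : ℂ) ^ 2 / 2) * Complex.exp (-x * t)‖ ≤ C := by
      refine norm_integral_le_of_norm_le hi ?_
      filter_upwards [ae_restrict_mem measurableSet_Ioi] with t ht
      have ht0 : (0 : ℝ) < t := ht
      have h2 := hre t 2
      rw [Complex.ofReal_ofNat] at h2
      have h3 : (-(x : ℂ) * t).re = -(x * t) := by simp
      rw [norm_mul, norm_mul, Complex.norm_cpow_eq_rpow_re_of_pos ht0, Complex.norm_exp,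
        Complex.norm_exp, h2, h3]
      have h4 : Real.exp (-(x * t)) ≤ 1 := Real.exp_le_one_iff.mpr (by nlinarith)
      simpa using mul_le_of_le_one_right (by positivity) h4
    have h2 := hre x 4
    rw [Complex.ofReal_ofNat] at h2
    rw [hK, norm_mul, norm_mul, Complex.norm_exp, h2]
    have h5 : Real.exp (-x ^ 2 / 4) ≤ Real.exp 4 * Real.exp (-2 * x) := by
      rw [← Real.exp_add]
      gcongr
      nlinarith [sq_nonneg (x / 2 - 2)]
    calc _ ≤ ‖K‖ * (Real.exp 4 * Real.exp (-2 * x)) * C := by gcongr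
      _ = _ := by ring
  intro k
  have h6 : (fun x : ℝ => (x : ℂ) ^ k * parabolicD ν x) =O[Filter.atTop]
      fun x : ℝ => x ^ k * Real.exp (-2 * x) := by
    refine Asymptotics.IsBigO.of_bound (‖K‖ * C * Real.exp 4) ?_
    filter_upwards [Filter.eventually_ge_atTop 0] with x hx
    have := hb x hx
    rw [norm_mul, norm_pow, Complex.norm_real, norm_mul, norm_pow, Real.norm_of_nonneg hx,
      Real.norm_of_nonneg (Real.exp_nonneg _)]
    calc x ^ k * ‖parabolicD ν x‖ ≤ x ^ k * (‖K‖ * C * Real.exp 4 * Real.exp (-2 * x)) := by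
          gcongr
      _ = _ := by ring
  refine h6.trans ?_
  have h7 := (isLittleO_pow_exp_pos_mul_atTop k (b := 1) one_pos).isBigO.mul
    (Asymptotics.isBigO_refl (fun x : ℝ => Real.exp (-2 * x)) Filter.atTop)
  refine h7.congr_right fun x => ?_
  rw [← Real.exp_add]
  congr 1
  ring

/-- Induction on half-planes re ν < n: the recurrence expresses D_ν through indices ν - 1 and ν - 2.
-/
theorem rapidDecay_parabolicD (ν : ℂ) : RapidDecay fun x => parabolicD ν x := by
  have h : ∀ n : ℕ, ∀ ν : ℂ, ν.re < n → RapidDecay fun x => parabolicD ν x := by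
    intro n
    induction n with
    | zero => exact fun ν hν => rapidDecay_parabolicD_of_re_neg (by simpa using hν)
    | succ n ih =>
      intro ν hν
      push_cast at hν
      have h1 := ih (ν - 1) (by simp only [Complex.sub_re, Complex.one_re]; linarith)
      have h2 := ih (ν - 1 - 1) (by simp only [Complex.sub_re, Complex.one_re]; linarith)
      have e : ∀ x : ℝ, parabolicD ν x =
          x * parabolicD (ν - 1) x - (ν - 1) * parabolicD (ν - 1 - 1) x := fun x => by
        simpa using parabolicD_add_one (ν - 1) x
      simp only [e]
      exact h1.id_mul.sub (h2.const_mul _)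
  obtain ⟨n, hn⟩ := exists_nat_gt ν.re
  exact h n ν hn

theorem rapidDecay_parabolicDDeriv (ν : ℂ) : RapidDecay fun x => parabolicDDeriv ν x := by
  have e : ∀ x : ℝ, parabolicDDeriv ν x =
      ν * parabolicD (ν - 1) x - (1 / 2) * (x * parabolicD ν x) := fun x => by
    rw [parabolicDDeriv]
    ring
  simp only [e]
  exact ((rapidDecay_parabolicD _).const_mul _).sub ((rapidDecay_parabolicD ν).id_mul.const_mul _)

theorem RapidDecay.integrableOn_norm_sq {f : ℝ → ℂ} (hf : RapidDecay f) (hc : Continuous f)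
    (a : ℝ) : IntegrableOn (fun x => ‖f x‖ ^ 2) (Set.Ioi a) := by
  have h0 : f =O[Filter.atTop] fun x : ℝ => Real.exp (-1 * x) := by simpa using hf 0
  refine integrable_of_isBigO_exp_neg (b := 2) two_pos (by fun_prop) ?_
  have := h0.norm_left.pow 2
  refine this.congr_right fun x => ?_
  rw [← Real.exp_nat_mul]
  congr 1
  push_cast
  ring

/-! ### Functions in the form domain as primitives of their weak derivatives -/

theorem absolutelyContinuousOnInterval_integral_complex {p : ℝ → ℂ} {a b : ℝ}
    (hp : IntervalIntegrable p volume a b) :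
    AbsolutelyContinuousOnInterval (fun x => ∫ t in a..x, p t) a b := by
  have hre : IntervalIntegrable (fun x => (p x).re) volume a b := ⟨hp.1.re, hp.2.re⟩
  have him : IntervalIntegrable (fun x => (p x).im) volume a b := ⟨hp.1.im, hp.2.im⟩
  have hc : ∀ c : ℂ, AbsolutelyContinuousOnInterval (fun _ : ℝ => c) a b := fun c =>
    (contDiffOn_const (n := 1)).absolutelyContinuousOnInterval
  have h := ((hre.absolutelyContinuousOnInterval_intervalIntegral (c := a) (by simp)).smul
    (hc 1)).add ((him.absolutelyContinuousOnInterval_intervalIntegral (c := a) (by simp)).smul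
    (hc Complex.I))
  have key : ∀ x ∈ Set.uIcc a b, (∫ t in a..x, p t) =
      (∫ t in a..x, (p t).re : ℝ) • (1 : ℂ) + (∫ t in a..x, (p t).im : ℝ) • Complex.I := by
    intro x hx
    have hs : Set.uIcc a x ⊆ Set.uIcc a b := Set.uIcc_subset_uIcc_left hx
    have i1 : IntervalIntegrable (fun x => ((p x).re : ℂ)) volume a x := by
      have := hre.mono_set hs
      exact ⟨this.1.ofReal, this.2.ofReal⟩
    have i2 : IntervalIntegrable (fun x => ((p x).im : ℂ)) volume a x := by
      have := him.mono_set hs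
      exact ⟨this.1.ofReal, this.2.ofReal⟩
    rw [Complex.real_smul, Complex.real_smul, ← intervalIntegral.integral_ofReal,
      ← intervalIntegral.integral_ofReal, mul_one, ← intervalIntegral.integral_mul_const,
      ← intervalIntegral.integral_add i1 (i2.mul_const _)]
    refine intervalIntegral.integral_congr fun t _ => ?_
    exact (Complex.re_add_im (p t)).symm
  rw [absolutelyContinuousOnInterval_iff] at h ⊢
  intro ε hε
  obtain ⟨δ, hδ, H⟩ := h ε hε
  refine ⟨δ, hδ, fun E hE hEδ => ?_⟩
  convert H E hE hEδ using 1
  refine Finset.sum_congr rfl fun i hi => ?_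
  have h1 := (hE.1 i hi).1
  have h2 := (hE.1 i hi).2
  rw [key _ h1, key _ h2]
  rfl

/-- The product rule for a primitive of an integrable function and a `C¹` function. -/
theorem integral_primitive_mul {p P V V' : ℝ → ℂ} {a b : ℝ}
    (hp : IntervalIntegrable p volume a b) (hP : ∀ x ∈ Set.uIcc a b, P x = P a + ∫ t in a..x, p t)
    (hV : ∀ x, HasDerivAt V (V' x) x) (hV' : Continuous V') :
    ∫ x in a..b, (p x * V x + P x * V' x) = P b * V b - P a * V a := by
  have hVc : Continuous V := continuous_iff_continuousAt.mpr fun x => (hV x).continuousAt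
  set Q : ℝ → ℂ := fun x => P a + ∫ t in a..x, p t with hQ
  have hV1 : ContDiff ℝ 1 V := by
    rw [contDiff_one_iff_deriv]
    refine ⟨fun x => (hV x).differentiableAt, ?_⟩
    rwa [show deriv V = V' from funext fun x => (hV x).deriv]
  have hc : AbsolutelyContinuousOnInterval (fun _ : ℝ => P a) a b :=
    (contDiffOn_const (n := 1)).absolutelyContinuousOnInterval
  have hQac : AbsolutelyContinuousOnInterval Q a b :=
    hc.add (absolutelyContinuousOnInterval_integral_complex hp)
  have hVac : AbsolutelyContinuousOnInterval V a b := hV1.contDiffOn.absolutelyContinuousOnInterval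
  have hi : IntervalIntegrable (fun x => p x * V x + Q x * V' x) volume a b :=
    (hp.mul_continuousOn hVc.continuousOn).add
      (hQac.continuousOn.mul hV'.continuousOn).intervalIntegrable
  -- The product minus the primitive of its formal derivative is absolutely continuous with
  -- derivative zero almost everywhere, hence constant.
  have hG : AbsolutelyContinuousOnInterval
      (fun x => Q x * V x - ∫ t in a..x, (p t * V t + Q t * V' t)) a b :=
    (hQac.smul hVac).sub (absolutelyContinuousOnInterval_integral_complex hi)
  obtain ⟨C, hC⟩ := hG.const_of_ae_hasDerivAt_zero (by
    filter_upwards [hp.ae_hasDerivAt_integral, hi.ae_hasDerivAt_integral] with x h1 h2 hx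
    have d1 := (((h1 hx a (by simp)).const_add (P a)).mul (hV x)).sub (h2 hx a (by simp))
    convert! d1 using 1
    simp [hQ])
  have e1 := hC a (by simp)
  have e2 := hC b (by simp)
  have e3 : ∫ x in a..b, (p x * V x + P x * V' x) = ∫ x in a..b, (p x * V x + Q x * V' x) :=
    intervalIntegral.integral_congr fun x hx => by simp only [hP x hx, hQ]
  rw [e3, hP b (by simp)]
  have e4 : Q a = P a := by simp [hQ]
  rw [intervalIntegral.integral_same, sub_zero, e4] at e1
  change _ = Q b * V b - _
  rw [e1, ← e2]
  ring

/-- A continuous function whose weak derivative vanishes is constant. -/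
theorem eq_of_isWeakDeriv_zero {h : ℝ → ℂ} (hc : Continuous h) (hw : IsWeakDeriv h 0) (x y : ℝ) :
    h x = h y := by
  -- Each mollification is constant: its derivative at x pairs h with the derivative of the test
  -- function t ↦ φ(x - t), up to sign. Shrinking the bumps then recovers h pointwise.
  have hconst : ∀ φ : ContDiffBump (0 : ℝ),
      convolution (φ.normed volume) h (ContinuousLinearMap.lsmul ℝ ℝ) volume x =
        convolution (φ.normed volume) h (ContinuousLinearMap.lsmul ℝ ℝ) volume y := by
    intro φ
    have hd : ∀ x, HasDerivAt
        (convolution (φ.normed volume) h (ContinuousLinearMap.lsmul ℝ ℝ) volume) 0 x := by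
      intro x
      have hφ1 : ContDiff ℝ ∞ (φ.normed volume) := φ.contDiff_normed
      have hφc : HasCompactSupport (φ.normed volume) := φ.hasCompactSupport_normed
      refine (hφc.hasDerivAt_convolution_left (μ := volume) (ContinuousLinearMap.lsmul ℝ ℝ)
        (hφ1.of_le (by simp)) hc.locallyIntegrable x).congr_deriv ?_
      rw [convolution_eq_swap]
      have hψ : ContDiff ℝ ∞ (fun t : ℝ => ((φ.normed volume (x - t) : ℝ) : ℂ)) :=
        Complex.ofRealCLM.contDiff.comp (hφ1.comp (contDiff_const.sub contDiff_id))
      have hψc : HasCompactSupport (fun t : ℝ => ((φ.normed volume (x - t) : ℝ) : ℂ)) :=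
        (hφc.comp_homeomorph (Homeomorph.subLeft x)).comp_left Complex.ofReal_zero
      have hψd : ∀ t, deriv (fun t : ℝ => ((φ.normed volume (x - t) : ℝ) : ℂ)) t =
          -((deriv (φ.normed volume) (x - t) : ℝ) : ℂ) := fun t => by
        have h1 := (hφ1.differentiable (by simp) (x - t)).hasDerivAt
        have h2 := (h1.comp t ((hasDerivAt_id t).const_sub x)).ofReal_comp
        simpa [Function.comp_def] using h2.deriv
      have := hw _ hψ hψc
      simp only [hψd, Pi.zero_apply, zero_mul, integral_zero, neg_zero, mul_neg] at this
      rw [integral_neg, neg_eq_zero] at this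
      rw [← this]
      refine integral_congr_ae (ae_of_all _ fun t => ?_)
      simp [mul_comm]
    exact is_const_of_deriv_eq_zero (fun x => (hd x).differentiableAt) (fun x => (hd x).deriv) x y
  let φ : ℕ → ContDiffBump (0 : ℝ) := fun n =>
    ⟨1 / (n + 1) / 2, 1 / (n + 1), by positivity, by
      have : (0 : ℝ) < 1 / (n + 1) := by positivity
      linarith⟩
  have hφ : Filter.Tendsto (fun n => (φ n).rOut) Filter.atTop (nhds 0) :=
    tendsto_one_div_add_atTop_nhds_zero_nat
  have t1 := ContDiffBump.convolution_tendsto_right_of_continuous (μ := volume) hφ hc x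
  have t2 := ContDiffBump.convolution_tendsto_right_of_continuous (μ := volume) hφ hc y
  exact tendsto_nhds_unique (by simpa only [hconst] using t1) t2

theorem locallyIntegrable_of_memLp_two {f : ℝ → ℂ} (hf : MemLp f 2 volume) :
    LocallyIntegrable f volume := hf.locallyIntegrable (by norm_num)

/-- The primitive of the weak derivative has the same weak derivative, so it differs from the
continuous representative by a constant. -/
theorem FormDomain.eq_add_integral (g : FormDomain) (a x : ℝ) :
    g.toFun x = g.toFun a + ∫ t in a..x, g.wderiv t := by
  have hli : ∀ a b, IntervalIntegrable g.wderiv volume a b := fun a b =>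
    ((locallyIntegrable_of_memLp_two g.memLp_wderiv).integrableOn_isCompact
      isCompact_uIcc).intervalIntegrable
  set P : ℝ → ℂ := fun x => ∫ t in a..x, g.wderiv t with hP
  have hPc : Continuous P := intervalIntegral.continuous_primitive hli a
  have hPw : IsWeakDeriv P g.wderiv := by
    intro φ hφ hc
    have hφd := hφ.continuous_deriv (by simp : (1 : WithTop ℕ∞) ≤ ∞)
    obtain ⟨R, hR⟩ := hc.isCompact.isBounded.subset_closedBall 0
    have hR' : ∀ x, R < |x| → φ x = 0 := fun x hx => by
      by_contra h
      have := hR (subset_tsupport φ h)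
      rw [Metric.mem_closedBall, dist_zero_right, Real.norm_eq_abs] at this
      linarith
    obtain ⟨S, hS0, hS⟩ : ∃ S : ℝ, 0 < S ∧ R < S :=
      ⟨max R 0 + 1, by positivity, by linarith [le_max_left R 0]⟩
    have z1 : φ S = 0 := hR' S (by rwa [abs_of_pos hS0])
    have z2 : φ (-S) = 0 := hR' (-S) (by rwa [abs_neg, abs_of_pos hS0])
    have key := integral_primitive_mul (p := g.wderiv) (P := P) (V := φ) (V' := deriv φ)
      (a := -S) (b := S) (hli _ _) (fun x _ => by
        simp only [hP]
        rw [intervalIntegral.integral_add_adjacent_intervals (hli _ _) (hli _ _)])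
      (fun x => (hφ.differentiable (by simp) x).hasDerivAt) hφd
    rw [z1, z2, mul_zero, mul_zero, sub_zero] at key
    have hsub : ∀ x, x ∉ Set.Ioc (-S) S → R < |x| := fun x hx => by
      by_contra h
      push Not at h
      exact hx ⟨by linarith [(abs_le.mp h).1], by linarith [(abs_le.mp h).2]⟩
    have s1 : Function.support (fun x => g.wderiv x * φ x + P x * deriv φ x) ⊆
        Set.Ioc (-S) S := by
      intro x hx
      by_contra hxS
      refine hx ?_
      have hn : x ∉ tsupport φ := fun hm => by
        have := hR hm
        rw [Metric.mem_closedBall, dist_zero_right, Real.norm_eq_abs] at this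
        linarith [hsub x hxS]
      have hd0 : deriv φ x = 0 := by
        by_contra h
        exact hn (tsupport_deriv_subset (f := φ) (subset_tsupport _ h))
      simp [hR' x (hsub x hxS), hd0]
    rw [intervalIntegral.integral_eq_integral_of_support_subset s1, integral_add] at key
    · rw [eq_neg_iff_add_eq_zero, add_comm]
      exact key
    · exact (g.memLp_wderiv.integrable_mul (memLp_test hφ.continuous hc))
    · exact (hPc.mul hφd).integrable_of_hasCompactSupport hc.deriv.mul_left
  have hw : IsWeakDeriv (fun x => g.toFun x - P x) 0 := by
    intro φ hφ hc
    have hφd := hφ.continuous_deriv (by simp : (1 : WithTop ℕ∞) ≤ ∞)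
    have e1 := g.isWeakDeriv φ hφ hc
    have e2 := hPw φ hφ hc
    simp only [sub_mul, Pi.zero_apply, zero_mul, integral_zero, neg_zero]
    rw [integral_sub, e1, e2, sub_self]
    · exact (g.continuous_toFun.mul hφd).integrable_of_hasCompactSupport hc.deriv.mul_left
    · exact (hPc.mul hφd).integrable_of_hasCompactSupport hc.deriv.mul_left
  have := eq_of_isWeakDeriv_zero (g.continuous_toFun.sub hPc) hw x a
  simp only [hP, Pi.sub_apply, intervalIntegral.integral_same, sub_zero] at this
  rw [← this]
  ring

/-! ### Integration by parts against functions with a jump -/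

theorem RapidDecay.neg {f : ℝ → ℂ} (hf : RapidDecay f) : RapidDecay fun x => -f x := by
  simpa only [neg_one_mul] using hf.const_mul (-1)

/-- A continuously differentiable function decaying rapidly at `+∞` with its derivative. -/
structure DecayingPair (u u' : ℝ → ℂ) : Prop where
  hasDerivAt : ∀ x, HasDerivAt u (u' x) x
  continuous_deriv : Continuous u'
  decay : RapidDecay u
  decay_deriv : RapidDecay u'

theorem DecayingPair.continuous {u u' : ℝ → ℂ} (h : DecayingPair u u') : Continuous u :=
  continuous_iff_continuousAt.mpr fun x => (h.hasDerivAt x).continuousAt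

theorem DecayingPair.const_mul {u u' : ℝ → ℂ} (h : DecayingPair u u') (c : ℂ) :
    DecayingPair (fun x => c * u x) (fun x => c * u' x) where
  hasDerivAt x := (h.hasDerivAt x).const_mul c
  continuous_deriv := continuous_const.mul h.continuous_deriv
  decay := h.decay.const_mul c
  decay_deriv := h.decay_deriv.const_mul c

theorem RapidDecay.memLp_Ioi {u : ℝ → ℂ} (hu : RapidDecay u) (hc : Continuous u) (s : ℝ) :
    MemLp u 2 (volume.restrict (Set.Ioi s)) :=
  (memLp_two_iff_integrable_sq_norm hc.aestronglyMeasurable).mpr (hu.integrableOn_norm_sq hc s)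

/-- A pair of square integrable functions on the line, the first a primitive of the second. -/
structure SobolevPair (P p : ℝ → ℂ) : Prop where
  memLp : MemLp P 2 volume
  memLp_deriv : MemLp p 2 volume
  eq_add_integral : ∀ a x, P x = P a + ∫ t in a..x, p t

theorem SobolevPair.reflect {P p : ℝ → ℂ} (h : SobolevPair P p) :
    SobolevPair (fun x => P (-x)) (fun x => -p (-x)) where
  memLp := h.memLp.comp_measurePreserving (Measure.measurePreserving_neg volume)
  memLp_deriv := (h.memLp_deriv.comp_measurePreserving (Measure.measurePreserving_neg volume)).neg
  eq_add_integral a x := by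
    rw [intervalIntegral.integral_neg, intervalIntegral.integral_comp_neg, h.eq_add_integral (-a),
      intervalIntegral.integral_symm]

theorem FormDomain.sobolevPair (g : FormDomain) : SobolevPair g.toFun g.wderiv :=
  ⟨g.memLp_toFun, g.memLp_wderiv, g.eq_add_integral⟩

theorem SobolevPair.conj {P p : ℝ → ℂ} (h : SobolevPair P p) :
    SobolevPair (fun x => conj (P x)) (fun x => conj (p x)) where
  memLp := h.memLp.star
  memLp_deriv := h.memLp_deriv.star
  eq_add_integral a x := by
    have : ∫ t in a..x, (starRingEnd ℂ) (p t) = conj (∫ t in a..x, p t) := by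
      simp only [intervalIntegral, map_sub, integral_conj]
    rw [h.eq_add_integral a x, map_add, this]

/-- From |p| ≤ 1 + |p|², P grows at most linearly, and rapid decay beats that. This kills the
boundary term at infinity. -/
theorem SobolevPair.tendsto_mul_zero {P p u : ℝ → ℂ} (h : SobolevPair P p) (hu : RapidDecay u) :
    Filter.Tendsto (fun x => P x * u x) Filter.atTop (nhds 0) := by
  have hsq : Integrable (fun x => ‖p x‖ ^ 2) :=
    (memLp_two_iff_integrable_sq_norm h.memLp_deriv.1).mp h.memLp_deriv
  set A : ℝ := ‖P 0‖ + ∫ x, ‖p x‖ ^ 2 with hA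
  have hb : ∀ x, 0 ≤ x → ‖P x‖ ≤ A + x := by
    intro x hx
    have i1 : IntervalIntegrable (fun t => 1 + ‖p t‖ ^ 2) volume 0 x :=
      intervalIntegrable_const.add hsq.intervalIntegrable
    have h1 : ‖∫ t in (0 : ℝ)..x, p t‖ ≤ ∫ t in (0 : ℝ)..x, (1 + ‖p t‖ ^ 2) :=
      intervalIntegral.norm_integral_le_of_norm_le hx
        (ae_of_all _ fun t _ => by nlinarith [sq_nonneg (‖p t‖ - 1), norm_nonneg (p t)]) i1
    rw [intervalIntegral.integral_add intervalIntegrable_const hsq.intervalIntegrable,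
      intervalIntegral.integral_const] at h1
    have h2 : ∫ t in Set.Ioc 0 x, ‖p t‖ ^ 2 ≤ ∫ t, ‖p t‖ ^ 2 :=
      setIntegral_le_integral hsq (ae_of_all _ fun t => sq_nonneg _)
    rw [← intervalIntegral.integral_of_le hx] at h2
    have h3 := norm_add_le (P 0) (∫ t in (0 : ℝ)..x, p t)
    rw [← h.eq_add_integral] at h3
    simp only [sub_zero, smul_eq_mul, mul_one] at h1
    linarith
  have hexp : Filter.Tendsto (fun x : ℝ => Real.exp (-1 * x)) Filter.atTop (nhds 0) := by
    simpa using Real.tendsto_exp_neg_atTop_nhds_zero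
  have t0 := ((hu 0).trans_tendsto hexp).norm
  have t1 := ((hu 1).trans_tendsto hexp).norm
  have t2 := (t0.const_mul A).add t1
  simp only [norm_zero, mul_zero, add_zero] at t2
  refine squeeze_zero_norm' ?_ t2
  filter_upwards [Filter.eventually_ge_atTop 0] with x hx
  rw [norm_mul, norm_mul, norm_mul, pow_zero, norm_one, one_mul, pow_one, Complex.norm_real,
    Real.norm_of_nonneg hx, ← add_mul]
  exact mul_le_mul_of_nonneg_right (hb x hx) (norm_nonneg _)

theorem SobolevPair.integrableOn_Ioi {P p u u' : ℝ → ℂ} (h : SobolevPair P p)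
    (hu : DecayingPair u u') (s : ℝ) :
    IntegrableOn (fun x => p x * u x + P x * u' x) (Set.Ioi s) :=
  ((h.memLp_deriv.restrict _).integrable_mul (hu.decay.memLp_Ioi hu.continuous s)).add
    ((h.memLp.restrict _).integrable_mul (hu.decay_deriv.memLp_Ioi hu.continuous_deriv s))

theorem SobolevPair.integral_Ioi {P p u u' : ℝ → ℂ} (h : SobolevPair P p)
    (hu : DecayingPair u u') (s : ℝ) :
    ∫ x in Set.Ioi s, (p x * u x + P x * u' x) = -(P s * u s) := by
  have t1 := intervalIntegral_tendsto_integral_Ioi s (h.integrableOn_Ioi hu s) Filter.tendsto_id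
  have e : ∀ x, ∫ t in s..x, (p t * u t + P t * u' t) = P x * u x - P s * u s := fun x =>
    integral_primitive_mul ((locallyIntegrable_of_memLp_two h.memLp_deriv).integrableOn_isCompact
      isCompact_uIcc).intervalIntegrable (fun x _ => h.eq_add_integral s x) hu.hasDerivAt
      hu.continuous_deriv
  simp only [id, e] at t1
  have t2 := (h.tendsto_mul_zero hu.decay).sub_const (P s * u s)
  rw [zero_sub] at t2
  exact tendsto_nhds_unique t1 t2

/-- The function equal to `v(-x)` for `x ≤ s` and to `u(x)` for `x > s`. -/
noncomputable def jump (s : ℝ) (v u : ℝ → ℂ) (x : ℝ) : ℂ := if x ≤ s then v (-x) else u x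

theorem SobolevPair.integrableOn_Iic {P p v v' : ℝ → ℂ} (h : SobolevPair P p)
    (hv : DecayingPair v v') (s : ℝ) :
    IntegrableOn (fun x => p x * v (-x) + P x * (-v' (-x))) (Set.Iic s) := by
  have h1 := (h.reflect.integrableOn_Ioi hv (-s)).neg
  have h2 := (integrableOn_Ici_iff_integrableOn_Ioi (μ := volume)).mpr h1
  have h3 := (Measure.measurePreserving_neg (volume : Measure ℝ)).integrableOn_comp_preimage
    (Homeomorph.neg ℝ).measurableEmbedding (f := fun x => -(-p (-x) * v x + P (-x) * v' x))
    (s := Set.Ici (-s))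
  have h4 := h3.mpr h2
  rw [Set.neg_preimage, Set.neg_Ici, neg_neg] at h4
  refine h4.congr_fun (fun x _ => ?_) measurableSet_Iic
  simp only [Function.comp, neg_neg]
  ring

theorem SobolevPair.integral_Iic {P p v v' : ℝ → ℂ} (h : SobolevPair P p)
    (hv : DecayingPair v v') (s : ℝ) :
    ∫ x in Set.Iic s, (p x * v (-x) + P x * (-v' (-x))) = P s * v (-s) := by
  have h1 := h.reflect.integral_Ioi hv (-s)
  have h2 := integral_comp_neg_Ioi (-s) fun x => p x * v (-x) + P x * (-v' (-x))
  rw [neg_neg] at h2 h1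
  rw [← h2, ← neg_inj, ← h1, ← integral_neg]
  refine integral_congr_ae (ae_of_all _ fun x => ?_)
  simp only [neg_neg]
  ring

/-- Integration by parts on each half-line leaves only P(s) times the jump at s. With zero jump it
shows that glued functions have weak derivatives; applied to the derivative of the Green function it
produces the delta term. -/
theorem SobolevPair.integral_jump {P p u u' v v' : ℝ → ℂ} (h : SobolevPair P p)
    (hu : DecayingPair u u') (hv : DecayingPair v v') (s : ℝ) :
    ∫ x, (p x * jump s v u x + P x * jump s (fun y => -v' y) u' x) = P s * (v (-s) - u s) := by
  have e1 : Set.EqOn (fun x => p x * jump s v u x + P x * jump s (fun y => -v' y) u' x)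
      (fun x => p x * v (-x) + P x * (-v' (-x))) (Set.Iic s) := fun x hx => by
    have : x ≤ s := hx
    simp [jump, this]
  have e2 : Set.EqOn (fun x => p x * jump s v u x + P x * jump s (fun y => -v' y) u' x)
      (fun x => p x * u x + P x * u' x) (Set.Ioi s) := fun x hx => by
    have : ¬ x ≤ s := not_le.mpr hx
    simp [jump, this]
  have i1 := (h.integrableOn_Iic hv s).congr_fun e1.symm measurableSet_Iic
  have i2 := (h.integrableOn_Ioi hu s).congr_fun e2.symm measurableSet_Ioi
  rw [← intervalIntegral.integral_Iic_add_Ioi i1 i2, setIntegral_congr_fun measurableSet_Iic e1,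
    setIntegral_congr_fun measurableSet_Ioi e2, h.integral_Iic hv, h.integral_Ioi hu]
  ring

theorem memLp_jump {u v : ℝ → ℂ} (hu : RapidDecay u) (huc : Continuous u) (hv : RapidDecay v)
    (hvc : Continuous v) (s : ℝ) : MemLp (jump s v u) 2 volume := by
  have h1 : MemLp (fun x => v (-x)) 2 (volume.restrict (Set.Iic s)) := by
    have h := (memLp_two_iff_integrable_sq_norm hvc.aestronglyMeasurable).mp
      (hv.memLp_Ioi hvc (-s))
    rw [memLp_two_iff_integrable_sq_norm (by fun_prop)]
    have h2 := (integrableOn_Ici_iff_integrableOn_Ioi (μ := volume)).mpr h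
    have h4 := ((Measure.measurePreserving_neg (volume : Measure ℝ)).integrableOn_comp_preimage
      (Homeomorph.neg ℝ).measurableEmbedding (f := fun x => ‖v x‖ ^ 2)
      (s := Set.Ici (-s))).mpr h2
    rw [Set.neg_preimage, Set.neg_Ici, neg_neg] at h4
    exact h4
  have h2 : MemLp u 2 (volume.restrict (Set.Iic s)ᶜ) := by
    rw [Set.compl_Iic]
    exact hu.memLp_Ioi huc s
  classical
  convert! MemLp.piecewise measurableSet_Iic h1 h2 using 1

theorem continuous_jump {u v : ℝ → ℂ} (huc : Continuous u) (hvc : Continuous v) {s : ℝ}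
    (h : v (-s) = u s) : Continuous (jump s v u) :=
  Continuous.if_le (hvc.comp continuous_neg) huc continuous_id continuous_const
    fun x hx => by rw [hx, h]

theorem mul_jump (s : ℝ) (c : ℝ → ℂ) (v u : ℝ → ℂ) (x : ℝ) :
    c x * jump s v u x = jump s (fun y => c (-y) * v y) (fun y => c y * u y) x := by
  unfold jump
  split_ifs <;> simp

/-- The element of the form domain equal to `v(-x)` for `x ≤ s` and to `u(x)` for `x > s`. -/
noncomputable def FormDomain.ofJump {u u' v v' : ℝ → ℂ} (hu : DecayingPair u u')
    (hv : DecayingPair v v') (s : ℝ) (h : v (-s) = u s) : FormDomain where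
  toFun := jump s v u
  wderiv := jump s (fun y => -v' y) u'
  continuous_toFun := continuous_jump hu.continuous hv.continuous h
  memLp_toFun := memLp_jump hu.decay hu.continuous hv.decay hv.continuous s
  memLp_wderiv := memLp_jump hu.decay_deriv hu.continuous_deriv
    hv.decay_deriv.neg hv.continuous_deriv.neg s
  isWeakDeriv := by
    intro φ hφ hc
    have key := (FormDomain.ofTest φ hφ hc).sobolevPair.integral_jump hu hv s
    rw [h, sub_self, mul_zero] at key
    have m1 := memLp_jump hu.decay hu.continuous hv.decay hv.continuous s
    have m2 : MemLp (jump s (fun y => -v' y) u') 2 volume :=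
      memLp_jump hu.decay_deriv hu.continuous_deriv
        hv.decay_deriv.neg hv.continuous_deriv.neg s
    have n1 := (FormDomain.ofTest φ hφ hc).memLp_toFun
    have n2 := (FormDomain.ofTest φ hφ hc).memLp_wderiv
    have i1 : Integrable fun x => (FormDomain.ofTest φ hφ hc).wderiv x * jump s v u x :=
      n2.integrable_mul m1
    have i2 : Integrable fun x =>
      (FormDomain.ofTest φ hφ hc).toFun x * jump s (fun y => -v' y) u' x := n1.integrable_mul m2
    rw [integral_add i1 i2] at key
    simp only [FormDomain.ofTest] at key
    simp only [mul_comm _ (φ _), mul_comm _ (deriv φ _)]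
    exact eq_neg_of_add_eq_zero_left key
  memLp_mul := by
    have e : (fun x : ℝ => (x : ℂ) * jump s v u x) =
        jump s (fun y => ((-y : ℝ) : ℂ) * v y) (fun y => (y : ℂ) * u y) :=
      funext fun x => mul_jump s (fun y => (y : ℂ)) v u x
    rw [e]
    have hvc := hv.continuous
    have huc := hu.continuous
    refine memLp_jump hu.decay.id_mul (by fun_prop) ?_ (by fun_prop) s
    simpa using hv.decay.id_mul.neg

/-! ### The Green function and the characteristic equation -/

theorem decayingPair_parabolicD (ν : ℂ) :
    DecayingPair (fun x => parabolicD ν x) (fun x => parabolicDDeriv ν x) where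
  hasDerivAt x := (hasDerivAt_parabolicD ν x).comp_ofReal
  continuous_deriv := (differentiable_parabolicDDeriv ν).continuous.comp Complex.continuous_ofReal
  decay := rapidDecay_parabolicD ν
  decay_deriv := rapidDecay_parabolicDDeriv ν

theorem decayingPair_parabolicDDeriv (ν : ℂ) : DecayingPair (fun x => parabolicDDeriv ν x)
    (fun x => ((x : ℂ) ^ 2 / 4 - 1 / 2 - ν) * parabolicD ν x) where
  hasDerivAt x := (hasDerivAt_parabolicDDeriv ν x).comp_ofReal
  continuous_deriv := by
    have := (decayingPair_parabolicD ν).continuous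
    fun_prop
  decay := rapidDecay_parabolicDDeriv ν
  decay_deriv := by
    have h := (((rapidDecay_parabolicD ν).id_mul.id_mul).const_mul (1 / 4)).sub
      ((rapidDecay_parabolicD ν).const_mul (1 / 2 + ν))
    convert! h using 2
    ring

/-- The Green function `x ↦ D_ν(max(x, s)) D_ν(-min(x, s))`. -/
noncomputable def weberGreen (ν : ℂ) (s : ℝ) : FormDomain :=
  FormDomain.ofJump ((decayingPair_parabolicD ν).const_mul (parabolicD ν (-s : ℝ)))
    ((decayingPair_parabolicD ν).const_mul (parabolicD ν s)) s (mul_comm _ _)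

theorem weberGreen_of_le (ν : ℂ) {s x : ℝ} (h : x ≤ s) :
    (weberGreen ν s).toFun x = parabolicD ν s * parabolicD ν (-x : ℝ) := by
  simp [weberGreen, FormDomain.ofJump, jump, h]

theorem weberGreen_of_ge (ν : ℂ) {s x : ℝ} (h : s ≤ x) :
    (weberGreen ν s).toFun x = parabolicD ν (-s : ℝ) * parabolicD ν x := by
  rcases h.eq_or_lt with rfl | h
  · rw [weberGreen_of_le ν le_rfl, mul_comm]
  · simp [weberGreen, FormDomain.ofJump, jump, not_le.mpr h]

/-- Away from s the Green function solves the Weber equation; at s its derivative jumps by minus the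
Wronskian, which gives the evaluation of g at s. -/
theorem pcForm_zero_weberGreen (ν : ℂ) (b s : ℝ) (g : FormDomain) :
    pcForm 0 b (weberGreen ν s) g = ν * l2Pairing (weberGreen ν s).toFun g.toFun +
      weberWronskian ν * conj (g.toFun s) := by
  have key := g.sobolevPair.conj.integral_jump
    ((decayingPair_parabolicDDeriv ν).const_mul (parabolicD ν (-s : ℝ)))
    ((decayingPair_parabolicDDeriv ν).const_mul (-parabolicD ν s)) s
  have hW := wronskian_eq ν s
  set f := weberGreen ν s with hf
  have e1 : ∀ x : ℝ, jump s (fun y => -parabolicD ν s * parabolicDDeriv ν y)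
      (fun y => parabolicD ν (-s : ℝ) * parabolicDDeriv ν y) x = f.wderiv x := fun x => by
    simp [hf, weberGreen, FormDomain.ofJump]
  have e2 : ∀ x : ℝ, jump s
      (fun y => -(-parabolicD ν s * (((y : ℂ) ^ 2 / 4 - 1 / 2 - ν) * parabolicD ν y)))
      (fun y => parabolicD ν (-s : ℝ) * (((y : ℂ) ^ 2 / 4 - 1 / 2 - ν) * parabolicD ν y)) x =
      ((x : ℂ) ^ 2 / 4 - 1 / 2 - ν) * f.toFun x := fun x => by
    simp only [hf, weberGreen, FormDomain.ofJump, jump]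
    split_ifs
    · push_cast
      ring
    · ring
  simp only [e1, e2] at key
  have i1 := integrable_mul_conj f.memLp_wderiv g.memLp_wderiv
  have i2 := integrable_mul_conj f.memLp_mul g.memLp_mul
  have i3 := integrable_mul_conj f.memLp_toFun g.memLp_toFun
  have e3 : ∀ x : ℝ, conj (g.wderiv x) * f.wderiv x +
      conj (g.toFun x) * (((x : ℂ) ^ 2 / 4 - 1 / 2 - ν) * f.toFun x) =
      (f.wderiv x * conj (g.wderiv x) +
        1 / 4 * ((x : ℂ) * f.toFun x * conj ((x : ℂ) * g.toFun x))) -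
        (1 / 2 + ν) * (f.toFun x * conj (g.toFun x)) := fun x => by
    rw [map_mul, Complex.conj_ofReal]
    ring
  simp only [e3] at key
  have i4 : Integrable fun x : ℝ => f.wderiv x * conj (g.wderiv x) +
      1 / 4 * ((x : ℂ) * f.toFun x * conj ((x : ℂ) * g.toFun x)) := i1.add (i2.const_mul _)
  rw [integral_sub i4 (i3.const_mul _), integral_add i1 (i2.const_mul _),
    integral_const_mul, integral_const_mul] at key
  simp only [pcForm, l2Pairing]
  push_cast at key
  linear_combination key + conj (g.toFun s) * hW

theorem pcForm_eq_zero_add (z : ℂ) (b : ℝ) (f g : FormDomain) : pcForm z b f g =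
    pcForm 0 b f g + z * (f.toFun b * conj (g.toFun b) - f.toFun (-b) * conj (g.toFun (-b))) := by
  simp [pcForm]

/-- A form eigenfunction is an eigenfunction of the operator. -/
theorem isEigenvalue_of_pcForm {z ν : ℂ} {b : ℝ} (f : FormDomain) (hf : f.toFun ≠ 0)
    (h : ∀ g : FormDomain, pcForm z b f g = ν * l2Pairing f.toFun g.toFun) :
    IsEigenvalue (pcOperator z b) ν := by
  set y : Lp ℂ 2 (volume : Measure ℝ) := f.memLp_toFun.toLp with hy
  have hyf : (y : ℝ → ℂ) =ᵐ[volume] f.toFun := f.memLp_toFun.coeFn_toLp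
  have hmem : (y, ν • y) ∈ (pcOperator z b).graph := by
    rw [pcOperator_graph]
    refine ⟨f, hyf.symm, fun g => ?_⟩
    have e : ((ν • y : Lp ℂ 2 (volume : Measure ℝ)) : ℝ → ℂ) =ᵐ[volume]
        fun x => ν * f.toFun x := by
      filter_upwards [Lp.coeFn_smul ν y, hyf] with x h1 h2
      rw [h1, Pi.smul_apply, h2, smul_eq_mul]
    rw [h g, l2Pairing_congr e, l2Pairing_smul]
  obtain ⟨w, hw1, hw2⟩ := (LinearPMap.mem_graph_iff _).mp hmem
  refine ⟨w, ?_, ?_⟩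
  · rw [hw1]
    intro h0
    refine hf ((f.continuous_toFun.ae_eq_iff_eq volume continuous_zero).mp ?_)
    have h0' : y = 0 := h0
    rw [h0'] at hyf
    exact hyf.symm.trans (Lp.coeFn_zero ℂ 2 (volume : Measure ℝ))
  · rw [hw2, hw1]

/-- With m = D(b)D(-b) and n = D(b)², the coefficients of conj(g(b)) and conj(g(-b)) must vanish.
The hypothesis says that the determinant of this system in (p, q) is zero. -/
theorem isEigenvalue_of_characteristic {z ν : ℂ} {b : ℝ} (hb : 0 < b)
    (hW : weberWronskian ν ≠ 0)
    (h : weberWronskian ν ^ 2 = z ^ 2 * (parabolicD ν b ^ 2 *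
      (parabolicD ν (-b : ℝ) ^ 2 - parabolicD ν b ^ 2))) :
    IsEigenvalue (pcOperator z b) ν := by
  set W := weberWronskian ν
  set m := parabolicD ν b * parabolicD ν (-b : ℝ) with hm
  set n := parabolicD ν b ^ 2 with hn
  have hbb : -b ≤ b := by linarith
  have g1 : (weberGreen ν b).toFun b = m := weberGreen_of_le ν le_rfl
  have g2 : (weberGreen ν b).toFun (-b) = n := by
    rw [weberGreen_of_le ν hbb, neg_neg, hn, sq]
  have g3 : (weberGreen ν (-b)).toFun b = n := by
    rw [weberGreen_of_ge ν hbb, neg_neg, hn, sq]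
  have g4 : (weberGreen ν (-b)).toFun (-b) = m := by
    rw [weberGreen_of_ge ν le_rfl, neg_neg]
  obtain ⟨p, q, hpq, h1, h2⟩ : ∃ p q : ℂ, ¬(p = 0 ∧ q = 0) ∧
      W * p + z * (p * m + q * n) = 0 ∧ W * q - z * (p * n + q * m) = 0 := by
    -- The natural kernel vector of the first row is (-zn, W + zm). If it is zero, that row vanishes
    -- and (1, 0) solves both equations.
    by_cases hc : z * n = 0 ∧ W + z * m = 0
    · exact ⟨1, 0, by simp, by linear_combination hc.2, by linear_combination -hc.1⟩
    · refine ⟨-(z * n), W + z * m, by simpa using hc, by ring, ?_⟩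
      linear_combination h + z ^ 2 * (n + parabolicD ν b ^ 2) * hn -
        z ^ 2 * (m + parabolicD ν b * parabolicD ν (-b : ℝ)) * hm
  set f := ((weberGreen ν b).smul p).add ((weberGreen ν (-b)).smul q) with hf
  have f1 : f.toFun b = p * m + q * n := by
    change p * (weberGreen ν b).toFun b + q * (weberGreen ν (-b)).toFun b = _
    rw [g1, g3]
  have f2 : f.toFun (-b) = p * n + q * m := by
    change p * (weberGreen ν b).toFun (-b) + q * (weberGreen ν (-b)).toFun (-b) = _
    rw [g2, g4]
  refine isEigenvalue_of_pcForm f (fun h0 => hpq ?_) fun g => ?_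
  -- If f were zero, its values at ±b would vanish, and the system would reduce to Wp = Wq = 0.
  · rw [← f1, h0] at h1
    rw [← f2, h0] at h2
    simpa [hW] using And.intro h1 h2
  · have e : l2Pairing f.toFun g.toFun = p * l2Pairing (weberGreen ν b).toFun g.toFun +
        q * l2Pairing (weberGreen ν (-b)).toFun g.toFun := by
      rw [← l2Pairing_smul, ← l2Pairing_smul, ← l2Pairing_add]
      · rfl
      · exact (weberGreen ν b).memLp_toFun.const_mul p
      · exact (weberGreen ν (-b)).memLp_toFun.const_mul q
      · exact g.memLp_toFun
    rw [pcForm_eq_zero_add, f1, f2, e, hf, pcForm_add, pcForm_smul, pcForm_smul,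
      pcForm_zero_weberGreen, pcForm_zero_weberGreen]
    linear_combination conj (g.toFun b) * h1 + conj (g.toFun (-b)) * h2

/-! ### Zeros of the characteristic function near a zero of `D_ν(b)` -/

/-- The function `ν ↦ D_ν(b)² (D_ν(-b)² - D_ν(b)²) / W(ν)²`, whose value is `z⁻²` at the
eigenvalues of `L_{z,b}`. -/
noncomputable def characteristicFunction (b : ℝ) (ν : ℂ) : ℂ :=
  parabolicD ν b ^ 2 * (parabolicD ν (-b : ℝ) ^ 2 - parabolicD ν b ^ 2) / weberWronskian ν ^ 2

theorem parabolicD_neg_ne_zero {ν : ℂ} {b : ℝ} (hW : weberWronskian ν ≠ 0)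
    (hD : parabolicD ν b = 0) : parabolicD ν (-b : ℝ) ≠ 0 := by
  intro h
  refine hW ?_
  push_cast at h
  rw [← wronskian_eq ν b, hD, h]
  simp

/-- Identity theorem in the index, contradicted at ν = 0. -/
theorem not_eventually_parabolicD_eq_zero (b : ℝ) (lam : ℂ) :
    ¬ ∀ᶠ ν in nhds lam, parabolicD ν b = 0 := by
  intro h
  have ha : AnalyticOnNhd ℂ (fun ν => parabolicD ν b) Set.univ :=
    Complex.analyticOnNhd_univ_iff_differentiable.mpr (differentiable_parabolicD_index b)
  have h0 := ha.eq_of_eventuallyEq (g := fun _ => 0) analyticOnNhd_const h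
  exact parabolicD_zero_ne_zero b (congrFun h0 0)

theorem parabolicD_im_eq_zero {ν : ℂ} (hν : ν.im = 0) (x : ℝ) : (parabolicD ν x).im = 0 := by
  have h := parabolicD_conj ν x
  rw [Complex.conj_eq_iff_im.mpr hν] at h
  exact Complex.conj_eq_iff_im.mp h.symm

theorem weberWronskian_im_eq_zero {ν : ℂ} (hν : ν.im = 0) : (weberWronskian ν).im = 0 := by
  have h := weberWronskian_conj ν
  rw [Complex.conj_eq_iff_im.mpr hν] at h
  exact Complex.conj_eq_iff_im.mp h.symm

/-- At λ the difference of squares equals D_λ(-b)², the square of a nonzero real; continuity in ν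
does the rest. -/
theorem eventually_characteristic_admissible {b : ℝ} {lam : ℝ} (hlam : ∀ n : ℕ, lam ≠ n)
    (hD : parabolicD lam b = 0) : ∀ᶠ ν : ℂ in nhds (lam : ℂ), weberWronskian ν ≠ 0 ∧
      0 < (parabolicD ν (-b : ℝ) ^ 2 - parabolicD ν b ^ 2).re := by
  have hW : weberWronskian lam ≠ 0 := weberWronskian_ne_zero fun n => by exact_mod_cast hlam n
  have hc := (differentiable_parabolicD_index b).continuous
  have hc' := (differentiable_parabolicD_index (-b : ℝ)).continuous
  refine (differentiable_weberWronskian.continuous.continuousAt.eventually_ne hW).and ?_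
  have hcont : Continuous fun ν : ℂ => (parabolicD ν (-b : ℝ) ^ 2 - parabolicD ν b ^ 2).re :=
    Complex.continuous_re.comp ((hc'.pow 2).sub (hc.pow 2))
  refine hcont.continuousAt.eventually_const_lt ?_
  have h1 := parabolicD_neg_ne_zero hW hD
  have h2 := parabolicD_im_eq_zero (Complex.ofReal_im lam) (-b)
  have h3 : (parabolicD lam (-b : ℝ)).re ≠ 0 := fun h => h1 (Complex.ext h h2)
  beta_reduce
  rw [hD, sq, sq, mul_zero, sub_zero, Complex.mul_re, h2]
  simpa using h3

/-- Open mapping theorem at λ. Local constancy would force D_ν(b) = 0 near λ, since the other factor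
of the numerator does not vanish there. -/
theorem nhds_zero_le_map_characteristicFunction {b : ℝ} {lam : ℝ} (hlam : ∀ n : ℕ, lam ≠ n)
    (hD : parabolicD lam b = 0) :
    nhds 0 ≤ Filter.map (characteristicFunction b) (nhds (lam : ℂ)) := by
  have hW : weberWronskian lam ≠ 0 := weberWronskian_ne_zero fun n => by exact_mod_cast hlam n
  have a1 := (differentiable_parabolicD_index b).analyticAt (lam : ℂ)
  have a2 := (differentiable_parabolicD_index (-b : ℝ)).analyticAt (lam : ℂ)
  have a3 := differentiable_weberWronskian.analyticAt (lam : ℂ)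
  have ha : AnalyticAt ℂ (characteristicFunction b) lam :=
    ((a1.pow 2).mul ((a2.pow 2).sub (a1.pow 2))).div (a3.pow 2) (pow_ne_zero 2 hW)
  have h0 : characteristicFunction b lam = 0 := by simp [characteristicFunction, hD]
  rcases ha.eventually_constant_or_nhds_le_map_nhds with h | h
  · refine (not_eventually_parabolicD_eq_zero b lam ?_).elim
    filter_upwards [h, eventually_characteristic_admissible hlam hD] with ν h1 ⟨h2, h3⟩
    have h4 : parabolicD ν (-b : ℝ) ^ 2 - parabolicD ν b ^ 2 ≠ 0 := fun h => by
      rw [h] at h3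
      exact lt_irrefl _ h3
    rw [h0] at h1
    rw [characteristicFunction, div_eq_zero_iff, mul_eq_zero] at h1
    simpa [h2, h4] using h1.resolve_right (pow_ne_zero 2 h2) |>.resolve_right h4
  · rwa [h0] at h

theorem characteristicFunction_re_nonneg {b : ℝ} {ν : ℂ} (hν : ν.im = 0)
    (h : 0 < (parabolicD ν (-b : ℝ) ^ 2 - parabolicD ν b ^ 2).re) :
    0 ≤ (characteristicFunction b ν).re := by
  have real : ∀ w : ℂ, w.im = 0 → w = (w.re : ℂ) := fun w hw => Complex.ext rfl (by simpa using hw)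
  have h1 := real _ (parabolicD_im_eq_zero hν b)
  have h2 := real _ (parabolicD_im_eq_zero hν (-b))
  have h3 := real _ (weberWronskian_im_eq_zero hν)
  rw [characteristicFunction]
  rw [h1, h2] at h ⊢
  rw [h3]
  norm_cast at h ⊢
  positivity

theorem characteristic_of_eq {b r : ℝ} {ν : ℂ} (hr : r ≠ 0) (hW : weberWronskian ν ≠ 0)
    (h : characteristicFunction b ν = -(1 / (r : ℂ) ^ 2)) :
    weberWronskian ν ^ 2 = (Complex.I * (r : ℂ)) ^ 2 * (parabolicD ν b ^ 2 *
      (parabolicD ν (-b : ℝ) ^ 2 - parabolicD ν b ^ 2)) := by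
  have hr' : (r : ℂ) ≠ 0 := by exact_mod_cast hr
  rw [characteristicFunction, div_eq_iff (pow_ne_zero 2 hW)] at h
  rw [h, mul_pow, Complex.I_sq]
  field_simp

/-- Only z² = -r² enters the equation, and it is real although z is not. -/
theorem characteristic_conj {b r : ℝ} {ν : ℂ}
    (h : weberWronskian ν ^ 2 = (Complex.I * (r : ℂ)) ^ 2 * (parabolicD ν b ^ 2 *
      (parabolicD ν (-b : ℝ) ^ 2 - parabolicD ν b ^ 2))) :
    weberWronskian (conj ν) ^ 2 = (Complex.I * (r : ℂ)) ^ 2 * (parabolicD (conj ν) b ^ 2 *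
      (parabolicD (conj ν) (-b : ℝ) ^ 2 - parabolicD (conj ν) b ^ 2)) := by
  have h1 := congrArg (starRingEnd ℂ) h
  simp only [map_mul, map_pow, map_sub, Complex.conj_I, Complex.conj_ofReal] at h1
  rw [weberWronskian_conj, parabolicD_conj, parabolicD_conj, h1]
  ring

end PointHarmonic

theorem mainTheorem8 (b : ℝ) (hb : 0 < b) (lam : ℝ) (hlam : 0 < lam)
    (hlamN : ∀ n : ℕ, lam ≠ (n : ℝ))
    (hD : PointHarmonic.parabolicD (lam : ℂ) (b : ℂ) = 0) (ρ : ℝ) (hρ : 0 < ρ) :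
    ∃ δ : ℝ, 0 < δ ∧ ∀ r : ℝ, 1 / δ < r →
      ∃ ν₁ ν₂ : ℂ, ν₁ ≠ ν₂ ∧
        (ν₁.im ≠ 0 ∧ ‖ν₁ - (lam : ℂ)‖ < ρ ∧
          PointHarmonic.IsEigenvalue (PointHarmonic.pcOperator (Complex.I * (r : ℂ)) b) ν₁) ∧
        (ν₂.im ≠ 0 ∧ ‖ν₂ - (lam : ℂ)‖ < ρ ∧
          PointHarmonic.IsEigenvalue (PointHarmonic.pcOperator (Complex.I * (r : ℂ)) b) ν₂) := by
  have hW := PointHarmonic.eventually_characteristic_admissible hlamN hD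
  have hball : ∀ᶠ ν : ℂ in nhds (lam : ℂ), ‖ν - (lam : ℂ)‖ < ρ := by
    filter_upwards [Metric.ball_mem_nhds (lam : ℂ) hρ] with ν hν
    simpa [dist_eq_norm] using hν
  have himg := PointHarmonic.nhds_zero_le_map_characteristicFunction hlamN hD
    (Filter.image_mem_map (hball.and hW))
  obtain ⟨ε, hε, hsub⟩ := Metric.mem_nhds_iff.mp himg
  -- For this δ, the condition r > 1/δ gives 1/r² < ε, which puts -1/r² in the ball covered by the
  -- image.
  refine ⟨Real.sqrt ε, Real.sqrt_pos.mpr hε, fun r hr => ?_⟩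
  have hs := Real.sqrt_pos.mpr hε
  have hr0 : 0 < r := lt_trans (by positivity) hr
  have hrε : 1 / r ^ 2 < ε := by
    have h1 : 1 / r < Real.sqrt ε := (one_div_lt hs hr0).mp hr
    calc 1 / r ^ 2 = (1 / r) ^ 2 := by rw [div_pow, one_pow]
      _ < Real.sqrt ε ^ 2 := by gcongr
      _ = ε := Real.sq_sqrt hε.le
  have hmem : -(1 / (r : ℂ) ^ 2) ∈ Metric.ball (0 : ℂ) ε := by
    simpa [abs_of_pos hr0] using hrε
  obtain ⟨ν, ⟨hνρ, hνW, hνD⟩, hν⟩ := hsub hmem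
  -- A real ν would give a nonnegative value, but the value is -1/r² < 0.
  have him : ν.im ≠ 0 := fun h => by
    have h1 := PointHarmonic.characteristicFunction_re_nonneg h hνD
    have h2 : (-(1 / (r : ℂ) ^ 2)).re = -(1 / r ^ 2) := by
      rw [show -(1 / (r : ℂ) ^ 2) = ((-(1 / r ^ 2) : ℝ) : ℂ) by push_cast; rfl, Complex.ofReal_re]
    rw [hν, h2] at h1
    have : 0 < 1 / r ^ 2 := by positivity
    linarith
  have hchar := PointHarmonic.characteristic_of_eq hr0.ne' hνW hν
  refine ⟨ν, conj ν, fun h => him (Complex.conj_eq_iff_im.mp h.symm), ⟨him, hνρ,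
    PointHarmonic.isEigenvalue_of_characteristic hb hνW hchar⟩, by simpa using him, ?_,
    PointHarmonic.isEigenvalue_of_characteristic hb ?_ (PointHarmonic.characteristic_conj hchar)⟩
  · rwa [← Complex.conj_ofReal lam, ← map_sub, Complex.norm_conj]
  · rw [PointHarmonic.weberWronskian_conj]
    exact (map_ne_zero _).mpr hνW
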